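/- \textbf{Theorem (variance reduction around the optimal solution).} Let $d\ge 1$, let $V:\mathbb{R}^d\to\mathbb{R}$ be twice continuously differentiable with $\int_{\mathbb{R}^d} e^{-V(x)}\,dx<\infty$, and let $\pi$ be the probability measure on $\mathbb{R}^d$ with density proportional to $e^{-V}$. Assume that the Laplacian $\Delta V=\sum_{i=1}^d \partial^2V/\partial x_i^2$ is $\ell$-Lipschitz for some $\ell\ge 0$, i.e. $|\Delta V(x)-\Delta V(y)|\le \ell\|x-y\|$ for all $x,y\in\mathbb{R}^d$. Let $\hat\pi=\mathcal N(\hat m,\hat\Sigma)$, with $\hat\Sigma$ positive definite, be a minimizer of $\mu\mapsto D_{\mathrm{KL}}(\mu\,\|\,\pi)$ over all Gaussian distributions $\mu$ on $\mathbb{R}^d$ with positive definite covariance matrix. Let $W_2$ be the 2-Wasserstein distance, $W_2^2(\mu,\nu)=\inf_\gamma\int\|x-y\|^2\,d\gamma(x,y)$, the infimum being over all couplings $\gamma$ of $\mu$ and $\nu$. Let $c\in(0,2)$. Then $r:=(2-c)\operatorname{Tr}(\hat\Sigma^{-1})>0$, and for every $\mu=\mathcal N(m,\Sigma)$ with $\Sigma$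 positive definite and $$2\ell\,W_2(\mu,\hat\pi)+c\,\bigl|\operatorname{Tr}(\Sigma^{-1})-\operatorname{Tr}(\hat\Sigma^{-1})\bigr|<r,$$ the control-variate estimator $\nabla V(X)-c\,\Sigma^{-1}(X-m)$ with $X\sim\mu$ has strictly smaller variance than the Monte Carlo estimator $\nabla V(X)$, where the variance of a random vector $Y$ is $\mathbb{E}\|Y-\mathbb{E}Y\|^2$. -/

import Mathlib

open MeasureTheory ProbabilityTheory
open scoped ENNReal NNReal Gradient Laplacian

noncomputable section

/-- The Bures–Wasserstein space: the Gaussian distributions on `ℝᵈ` with non-degenerate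
covariance matrix. -/
def buresWasserstein (d : ℕ) : Set (Measure (EuclideanSpace ℝ (Fin d))) :=
  {μ | ∃ (m : EuclideanSpace ℝ (Fin d)) (S : Matrix (Fin d) (Fin d) ℝ),
    S.PosDef ∧ μ = multivariateGaussian m S}

/-- The target distribution `π(x) ∝ exp (-V x)`, i.e. the measure with Lebesgue density
`exp (-V x) / ∫ exp (-V)`. It is a probability measure as soon as `exp (-V)` is integrable. -/
def targetMeasure {d : ℕ} (V : EuclideanSpace ℝ (Fin d) → ℝ) :
    Measure (EuclideanSpace ℝ (Fin d)) :=
  (volume : Measure (EuclideanSpace ℝ (Fin d))).tilted (fun x => -V x)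

/-- `ν` is an optimal Gaussian approximation of the target `π ∝ exp (-V)`: it minimises the
Kullback–Leibler divergence `D_KL(· ‖ π)` over the Bures–Wasserstein space. -/
def IsOptimalGaussian {d : ℕ} (V : EuclideanSpace ℝ (Fin d) → ℝ)
    (ν : Measure (EuclideanSpace ℝ (Fin d))) : Prop :=
  ν ∈ buresWasserstein d ∧
    IsMinOn (fun μ => InformationTheory.klDiv μ (targetMeasure V)) (buresWasserstein d) ν

/-- The transport plans between `μ` and `ν`. -/
def transportPlans {E : Type*} [MeasurableSpace E] (μ ν : Measure E) : Set (Measure (E × E)) :=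
  {γ | γ.map Prod.fst = μ ∧ γ.map Prod.snd = ν}

/-- The squared 2-Wasserstein distance, as an extended nonnegative real. -/
def wassersteinSq {E : Type*} [MeasurableSpace E] [NormedAddCommGroup E] (μ ν : Measure E) :
    ℝ≥0∞ :=
  ⨅ γ ∈ transportPlans μ ν, ∫⁻ p, ‖p.1 - p.2‖ₑ ^ 2 ∂γ

/-- The 2-Wasserstein distance, as a real number (the infimum defining it is finite for
probability measures with finite second moment, in particular for Gaussians). -/
def W₂ {E : Type*} [MeasurableSpace E] [NormedAddCommGroup E] (μ ν : Measure E) : ℝ :=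
  √(wassersteinSq μ ν).toReal

/-- The variance `𝔼 ‖Y - 𝔼 Y‖²` of a random vector, as an extended nonnegative real. On a
probability space it is `∞` exactly when (an a.e. strongly measurable) `Y` is not square
integrable. -/
def vecVariance {Ω E : Type*} [MeasurableSpace Ω] [NormedAddCommGroup E] [NormedSpace ℝ E]
    (Y : Ω → E) (P : Measure Ω) : ℝ≥0∞ :=
  ∫⁻ ω, ‖Y ω - ∫ ω', Y ω' ∂P‖ₑ ^ 2 ∂P

/-- The Monte Carlo estimator `∇V(x)`, at the sample `x`. -/
def mcEstimator {d : ℕ} (V : EuclideanSpace ℝ (Fin d) → ℝ) (x : EuclideanSpace ℝ (Fin d)) :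
    EuclideanSpace ℝ (Fin d) :=
  ∇ V x

/-- The control-variate estimator `∇V(x) - c Σ⁻¹ (x - m)`, at the sample `x`. -/
def cvEstimator {d : ℕ} (V : EuclideanSpace ℝ (Fin d) → ℝ) (c : ℝ)
    (m : EuclideanSpace ℝ (Fin d)) (S : Matrix (Fin d) (Fin d) ℝ)
    (x : EuclideanSpace ℝ (Fin d)) : EuclideanSpace ℝ (Fin d) :=
  ∇ V x - c • Matrix.toEuclideanCLM (𝕜 := ℝ) S⁻¹ (x - m)

end

/-!
Stein's identity for `μ = N(m, Σ)` gives `𝔼 ⟪∇V(X), Σ⁻¹(X - m)⟫ = 𝔼 Δ V(X)` and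
`𝔼 ‖Σ⁻¹(X - m)‖² = Tr Σ⁻¹`, so the control variate changes the variance by
`c² Tr Σ⁻¹ - 2 c 𝔼 Δ V(X)`, which is negative iff `c Tr Σ⁻¹ < 2 𝔼 Δ V(X)`. Stationarity of the
Kullback–Leibler divergence at `π̂` gives `𝔼_π̂ Δ V = Tr Σ̂⁻¹`, and `Δ V` being `ℓ`-Lipschitz, its
mean under `μ` differs from this by at most `ℓ W₂(μ, π̂)`.

All integrals exist because `V` and `∇V` have polynomial growth, although only `Δ V` is assumed to
be controlled. The radial derivative of a suitable weighted mean of `V` over a ball is an average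
of `Δ V`, so `V` differs from these means by a polynomially bounded error. Integrability of
`exp (-V)` bounds the means over unit balls, hence `V`, from below. Comparing the mean over a ball
of radius `R = 1 + ‖x‖` about `x` with the mean over the ball of radius `4 R` about `0` then bounds
`V x` from above, as in Harnack's inequality. For `∇V`, the mean value property is applied to
`V (· + h) - V`, whose Laplacian is at most `ℓ ‖h‖`, and the mean of `V` over a unit ball is
Lipschitz in the centre.
-/

section Divergence

variable {E : Type*} [NormedAddCommGroup E] [InnerProductSpace ℝ E]

/-- The divergence of the vector field `F`, defined without coordinates as the trace of its
derivative. -/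
noncomputable def divergence (F : E → E) (x : E) : ℝ := LinearMap.trace ℝ E (fderiv ℝ F x)

lemma divergence_eq_sum {ι : Type*} [Fintype ι] (b : OrthonormalBasis ι ℝ E) (F : E → E) (x : E) :
    divergence F x = ∑ i, inner ℝ (b i) (fderiv ℝ F x (b i)) := by
  simp [divergence, LinearMap.trace_eq_sum_inner _ b]

lemma divergence_comp_add_smul {F : E → E} (hF : Differentiable ℝ F) (x : E) (s : ℝ) (y : E) :
    divergence (fun y => F (x + s • y)) y = s * divergence F (x + s • y) := by
  have h := (hF (x + s • y)).hasFDerivAt.comp y (((hasFDerivAt_id y).const_smul s).const_add x)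
  have hF' : fderiv ℝ (fun y => F (x + s • y)) y = s • fderiv ℝ F (x + s • y) :=
    h.fderiv.trans (by ext; simp)
  simp [divergence, hF']

lemma divergence_clm_sub (L : E →L[ℝ] E) (m x : E) :
    divergence (fun x => L (x - m)) x = LinearMap.trace ℝ E L := by
  have hfderiv : HasFDerivAt (fun x => L (x - m)) L x := by
    simpa using L.hasFDerivAt.sub_const (L m)
  rw [divergence, hfderiv.fderiv]

lemma divergence_clm_comp_comp_add_clm {A B : E →L[ℝ] E} (hAB : A ∘L B = .id ℝ E) {F : E → E}
    (hF : Differentiable ℝ F) (m z : E) :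
    divergence (fun z => B (F (m + A z))) z = divergence F (m + A z) := by
  have hfderiv : HasFDerivAt (fun z => B (F (m + A z))) (B ∘L fderiv ℝ F (m + A z) ∘L A) z :=
    B.hasFDerivAt.comp z ((hF _).hasFDerivAt.comp z (A.hasFDerivAt.const_add m))
  rw [divergence, divergence, hfderiv.fderiv]
  calc LinearMap.trace ℝ E ((B : E →ₗ[ℝ] E) * (fderiv ℝ F (m + A z) * (A : E →ₗ[ℝ] E)))
      = LinearMap.trace ℝ E (fderiv ℝ F (m + A z) * ((A ∘L B : E →L[ℝ] E) : E →ₗ[ℝ] E)) := by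
        rw [LinearMap.trace_mul_comm, mul_assoc]; rfl
    _ = LinearMap.trace ℝ E (fderiv ℝ F (m + A z)) := by rw [hAB]; rfl

variable [FiniteDimensional ℝ E]

lemma continuous_divergence {F : E → E} (hF : ContDiff ℝ 1 F) : Continuous (divergence F) := by
  have hF' := hF.continuous_fderiv one_ne_zero
  simp only [funext (divergence_eq_sum (stdOrthonormalBasis ℝ E) F)]
  fun_prop

lemma divergence_smul {ρ : E → ℝ} {F : E → E} {x : E} (hρ : DifferentiableAt ℝ ρ x)
    (hF : DifferentiableAt ℝ F x) :
    divergence (fun x => ρ x • F x) x = ρ x * divergence F x + fderiv ℝ ρ x (F x) := by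
  rw [divergence, fderiv_fun_smul hρ hF]
  simp [divergence, LinearMap.trace_smulRight]

lemma contDiff_gradient {V : E → ℝ} (hV : ContDiff ℝ 2 V) : ContDiff ℝ 1 (∇ V) :=
  (InnerProductSpace.toDual ℝ E).symm.contDiff.comp (hV.fderiv_right le_rfl)

lemma divergence_gradient {V : E → ℝ} (hV : ContDiff ℝ 2 V) : divergence (∇ V) = Δ V := by
  ext x
  have hdiff := (hV.fderiv_right (m := 1) le_rfl).differentiable one_ne_zero x
  have hgrad := ((InnerProductSpace.toDual ℝ E).symm.toContinuousLinearEquiv.toContinuousLinearMap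
    |>.hasFDerivAt.comp x hdiff.hasFDerivAt).fderiv
  rw [divergence_eq_sum (stdOrthonormalBasis ℝ E),
    InnerProductSpace.laplacian_eq_iteratedFDeriv_stdOrthonormalBasis]
  refine Finset.sum_congr rfl fun i _ => ?_
  rw [iteratedFDeriv_two_apply, real_inner_comm]
  erw [hgrad]
  simp

variable [MeasurableSpace E] [BorelSpace E]

theorem integral_fderiv_apply_eq_neg_integral_divergence_mul {F : E → E} {q : E → ℝ}
    (hF : ContDiff ℝ 1 F) (hq : ContDiff ℝ 1 q) (hc : HasCompactSupport q) :
    ∫ y, fderiv ℝ q y (F y) = -∫ y, divergence F y * q y := by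
  let b := stdOrthonormalBasis ℝ E
  have hF' := hF.continuous_fderiv one_ne_zero
  have hq' := hq.continuous_fderiv one_ne_zero
  have hFi (i) (y) : fderiv ℝ (fun y => inner ℝ (b i) (F y)) y (b i)
      = inner ℝ (b i) (fderiv ℝ F y (b i)) := by
    simpa using fderiv_inner_apply ℝ (differentiableAt_const (b i))
      (hF.differentiable one_ne_zero y) (b i)
  have hint {f g : E → ℝ} (hf : Continuous f) (hg : Continuous g) (hgc : HasCompactSupport g) :
      Integrable (fun y => f y * g y) :=
    (hf.mul hg).integrable_of_hasCompactSupport hgc.mul_left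
  have hint_left (i) : Integrable fun y => inner ℝ (b i) (F y) * fderiv ℝ q y (b i) :=
    hint (by fun_prop) (by fun_prop) (hc.fderiv_apply ℝ _)
  have hint_right (i) : Integrable fun y => inner ℝ (b i) (fderiv ℝ F y (b i)) * q y :=
    hint (by fun_prop) hq.continuous hc
  have hcoord (i) : ∫ y, inner ℝ (b i) (F y) * fderiv ℝ q y (b i)
      = -∫ y, inner ℝ (b i) (fderiv ℝ F y (b i)) * q y := by
    simp only [← hFi]
    exact integral_mul_fderiv_eq_neg_fderiv_mul_of_integrable
      (by simpa only [hFi] using hint_right i) (hint_left i)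
      (hint (by fun_prop) hq.continuous hc)
      (fun y _ => (differentiableAt_const _).inner ℝ (hF.differentiable one_ne_zero y))
      (fun y _ => hq.differentiable one_ne_zero y)
  calc ∫ y, fderiv ℝ q y (F y) = ∫ y, ∑ i, inner ℝ (b i) (F y) * fderiv ℝ q y (b i) := by
        refine integral_congr_ae (.of_forall fun y => ?_)
        beta_reduce
        conv_lhs => rw [← b.sum_repr' (F y), map_sum]
        simp only [map_smul, smul_eq_mul]
    _ = ∑ i, -∫ y, inner ℝ (b i) (fderiv ℝ F y (b i)) * q y := by
        rw [integral_finsetSum _ fun i _ => hint_left i]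
        simp only [hcoord]
    _ = -∫ y, divergence F y * q y := by
        simp only [divergence_eq_sum b, Finset.sum_mul, Finset.sum_neg_distrib]
        rw [integral_finsetSum _ fun i _ => hint_right i]

end Divergence

section TruncatedParaboloid

variable {E : Type*} [NormedAddCommGroup E]

/-- The truncated paraboloid `max 0 (1 - ‖y‖²)`, the cutoff function of the development. It
averages `V` against a weight whose square has gradient `-4 (1 - ‖y‖²)₊ y`, which is what makes
the radial derivative of the average computable by the divergence theorem. -/
def truncParaboloid (y : E) : ℝ := max 0 (1 - ‖y‖ ^ 2)

lemma truncParaboloid_nonneg (y : E) : 0 ≤ truncParaboloid y := le_max_left _ _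

lemma truncParaboloid_le_one (y : E) : truncParaboloid y ≤ 1 :=
  max_le zero_le_one (by nlinarith [sq_nonneg ‖y‖])

lemma truncParaboloid_eq_zero {y : E} (hy : 1 ≤ ‖y‖) : truncParaboloid y = 0 :=
  max_eq_left (by nlinarith)

lemma truncParaboloid_of_norm_le {y : E} (hy : ‖y‖ ≤ 1) : truncParaboloid y = 1 - ‖y‖ ^ 2 :=
  max_eq_right (by nlinarith [norm_nonneg y])

@[fun_prop]
lemma continuous_truncParaboloid : Continuous (truncParaboloid : E → ℝ) := by
  unfold truncParaboloid
  fun_prop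

lemma hasCompactSupport_truncParaboloid [ProperSpace E] :
    HasCompactSupport (truncParaboloid : E → ℝ) :=
  HasCompactSupport.intro (isCompact_closedBall 0 1) fun y hy =>
    truncParaboloid_eq_zero (by simpa using (not_le.1 (mt mem_closedBall_zero_iff.2 hy)).le)

lemma lipschitzWith_truncParaboloid : LipschitzWith 2 (truncParaboloid : E → ℝ) := by
  refine LipschitzWith.of_le_add_mul 2 fun x y => ?_
  have htri : ‖y‖ - ‖x‖ ≤ dist x y := by
    simpa [dist_eq_norm, norm_sub_rev] using norm_sub_norm_le y x
  have hdist := dist_nonneg (x := x) (y := y)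
  rw [NNReal.coe_ofNat]
  rcases le_total 1 ‖x‖ with hx | hx
  · linarith [truncParaboloid_eq_zero hx, truncParaboloid_nonneg y]
  · rw [truncParaboloid_of_norm_le hx]
    have hy : 1 - ‖y‖ ^ 2 ≤ truncParaboloid y := le_max_right _ _
    rcases le_total ‖y‖ 1 with hy1 | hy1
    · nlinarith [norm_nonneg x, norm_nonneg y]
    · nlinarith [norm_nonneg x, truncParaboloid_nonneg y]

lemma truncParaboloid_inv_smul_sub_le [NormedSpace ℝ E] {R : ℝ} (hR : 0 < R) {x : E}
    (hx : ‖x‖ ≤ R) (z : E) :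
    truncParaboloid (R⁻¹ • (z - x)) ≤ 4 / 3 * truncParaboloid ((4 * R)⁻¹ • z) := by
  rcases le_total R ‖z - x‖ with hz | hz
  · rw [truncParaboloid_eq_zero]
    · exact mul_nonneg (by norm_num) (truncParaboloid_nonneg _)
    · rwa [norm_smul, norm_inv, Real.norm_of_nonneg hR.le, ← div_eq_inv_mul, one_le_div hR]
  · have hnorm : ‖(4 * R)⁻¹ • z‖ ≤ 1 / 2 := by
      rw [norm_smul, norm_inv, Real.norm_of_nonneg (by positivity), inv_mul_le_iff₀ (by positivity)]
      linarith [norm_le_norm_sub_add z x]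
    rw [truncParaboloid_of_norm_le (hnorm.trans (by norm_num))]
    nlinarith [truncParaboloid_le_one (R⁻¹ • (z - x)), norm_nonneg ((4 * R)⁻¹ • z)]

lemma hasDerivAt_max_zero_sq (t : ℝ) :
    HasDerivAt (fun t : ℝ => (max 0 t) ^ 2) (2 * max 0 t) t := by
  rcases lt_trichotomy t 0 with ht | rfl | ht
  · rw [max_eq_left ht.le, mul_zero]
    refine (hasDerivAt_const t (0 : ℝ)).congr_of_eventuallyEq ?_
    filter_upwards [Iio_mem_nhds ht] with u hu
    simp [max_eq_left (Set.mem_Iio.1 hu).le]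
  · have hle (u : ℝ) : ‖max 0 u ^ 2‖ ≤ ‖u ^ 2‖ := by
      rw [norm_pow, norm_pow]
      gcongr
      exact abs_max_le_max_abs_abs.trans (by simp)
    simpa [hasDerivAt_iff_isLittleO] using
      (Asymptotics.isBigO_of_le _ hle).trans_isLittleO (Asymptotics.isLittleO_pow_id one_lt_two)
  · rw [max_eq_right ht.le]
    refine (by simpa using hasDerivAt_pow 2 t :
      HasDerivAt (fun t : ℝ => t ^ 2) (2 * t) t).congr_of_eventuallyEq ?_
    filter_upwards [Ioi_mem_nhds ht] with u hu
    simp [max_eq_right (Set.mem_Ioi.1 hu).le]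

lemma mul_truncParaboloid_le_mul {f : E → ℝ} {y : E} {L : ℝ} (hf : ‖y‖ ≤ 1 → f y ≤ L) :
    f y * truncParaboloid y ≤ L * truncParaboloid y := by
  rcases le_total ‖y‖ 1 with hy | hy
  · exact mul_le_mul_of_nonneg_right (hf hy) (truncParaboloid_nonneg y)
  · simp [truncParaboloid_eq_zero hy]

variable [InnerProductSpace ℝ E]

lemma hasFDerivAt_truncParaboloid_smul_sq (r : ℝ) (y : E) :
    HasFDerivAt (fun y : E => truncParaboloid (r • y) ^ 2)
      (-(4 * r ^ 2 * truncParaboloid (r • y)) • innerSL ℝ y) y := by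
  have hnorm := ((hasStrictFDerivAt_norm_sq (r • y)).hasFDerivAt.comp y
    ((hasFDerivAt_id y).const_smul r)).const_sub 1
  refine ((hasDerivAt_max_zero_sq (1 - ‖r • y‖ ^ 2)).comp_hasFDerivAt y hnorm).congr_fderiv ?_
  ext v
  simp [truncParaboloid]
  ring

lemma contDiff_truncParaboloid_smul_sq (r : ℝ) :
    ContDiff ℝ 1 fun y : E => truncParaboloid (r • y) ^ 2 :=
  contDiff_one_iff_hasFDerivAt.2
    ⟨_, by fun_prop, fun y => hasFDerivAt_truncParaboloid_smul_sq r y⟩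

variable [FiniteDimensional ℝ E]

lemma hasCompactSupport_truncParaboloid_smul {r : ℝ} (hr : r ≠ 0) :
    HasCompactSupport fun y : E => truncParaboloid (r • y) :=
  hasCompactSupport_truncParaboloid.comp_homeomorph (Homeomorph.smulOfNeZero r hr)

variable [MeasurableSpace E] [BorelSpace E]

lemma integral_truncParaboloid_pos : 0 < ∫ y : E, truncParaboloid y :=
  continuous_truncParaboloid.integral_pos_of_hasCompactSupport_nonneg_nonzero
    hasCompactSupport_truncParaboloid truncParaboloid_nonneg
    (x := 0) (by simp [truncParaboloid])

lemma integrable_mul_truncParaboloid {f : E → ℝ} (hf : Continuous f) :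
    Integrable fun y => f y * truncParaboloid y :=
  (hf.mul continuous_truncParaboloid).integrable_of_hasCompactSupport
    hasCompactSupport_truncParaboloid.mul_left

lemma norm_integral_mul_truncParaboloid_sq_le {f : E → ℝ} {L : ℝ}
    (hf : ∀ y, ‖y‖ ≤ 1 → ‖f y‖ ≤ L) :
    ‖∫ y, f y * truncParaboloid y ^ 2‖ ≤ L * ∫ y : E, truncParaboloid y := by
  rw [← integral_const_mul]
  refine norm_integral_le_of_norm_le (integrable_mul_truncParaboloid continuous_const)
    (.of_forall fun y => ?_)
  have hsq : truncParaboloid y ^ 2 ≤ truncParaboloid y :=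
    pow_le_of_le_one (truncParaboloid_nonneg y) (truncParaboloid_le_one y) two_ne_zero
  rw [norm_mul, norm_pow, Real.norm_of_nonneg (truncParaboloid_nonneg y)]
  exact (mul_le_mul_of_nonneg_left hsq (norm_nonneg _)).trans
    (mul_truncParaboloid_le_mul (f := (‖f ·‖)) (hf y))

lemma integral_inner_mul_truncParaboloid_smul {F : E → E} (hF : ContDiff ℝ 1 F) {r : ℝ}
    (hr : r ≠ 0) :
    4 * r ^ 2 * ∫ y, inner ℝ (F y) y * truncParaboloid (r • y)
      = ∫ y, divergence F y * truncParaboloid (r • y) ^ 2 := by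
  have h := integral_fderiv_apply_eq_neg_integral_divergence_mul hF
    (contDiff_truncParaboloid_smul_sq r)
    ((hasCompactSupport_truncParaboloid_smul hr).comp_left (g := (· ^ 2)) (by simp))
  rw [← neg_inj, ← h, ← neg_mul, ← integral_const_mul]
  refine integral_congr_ae (.of_forall fun y => ?_)
  simp only [(hasFDerivAt_truncParaboloid_smul_sq r y).fderiv, smul_apply,
    innerSL_apply_apply, smul_eq_mul, real_inner_comm]
  ring

end TruncatedParaboloid

section WeightedMean

lemma hasDerivAt_integral_comp_add_smul {α E : Type*} [MeasurableSpace α] {ν : Measure α}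
    [NormedAddCommGroup E] [NormedSpace ℝ E] [FiniteDimensional ℝ E] [MeasurableSpace E]
    [BorelSpace E] {V : E → ℝ}
    (hV : ContDiff ℝ 1 V) {p q : α → E} {w bound : α → ℝ} (hp : Measurable p)
    (hq : Measurable q) (hw : Measurable w) (s : ℝ)
    (hint : Integrable (fun z => V (p z + s • q z) * w z) ν)
    (hbound : ∀ z, ∀ r ∈ Metric.ball s 1, ‖fderiv ℝ V (p z + r • q z) (q z) * w z‖ ≤ bound z)
    (hbound_int : Integrable bound ν) :
    HasDerivAt (fun s => ∫ z, V (p z + s • q z) * w z ∂ν)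
      (∫ z, fderiv ℝ V (p z + s • q z) (q z) * w z ∂ν) s := by
  have hV' := hV.continuous_fderiv one_ne_zero
  have hmeas (r : ℝ) : Measurable fun z => V (p z + r • q z) * w z :=
    (hV.continuous.measurable.comp (hp.add (hq.const_smul r))).mul hw
  have hmeas' : Measurable fun z => fderiv ℝ V (p z + s • q z) (q z) * w z :=
    ((by fun_prop : Continuous fun y : E × E => fderiv ℝ V y.1 y.2).measurable.comp
      ((hp.add (hq.const_smul s)).prodMk hq)).mul hw
  refine (hasDerivAt_integral_of_dominated_loc_of_deriv_le (Metric.ball_mem_nhds s one_pos)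
    (.of_forall fun r => (hmeas r).aestronglyMeasurable) hint hmeas'.aestronglyMeasurable
    (.of_forall hbound) hbound_int (.of_forall fun z r _ => ?_)).2
  have hline : HasDerivAt (fun r : ℝ => p z + r • q z) (q z) r := by
    simpa using ((hasDerivAt_id r).smul_const (q z)).const_add (p z)
  exact ((hV.differentiable one_ne_zero _).hasFDerivAt.comp_hasDerivAt r hline).mul_const _

variable {E : Type*} [NormedAddCommGroup E] [InnerProductSpace ℝ E] [FiniteDimensional ℝ E]
  [MeasurableSpace E] [BorelSpace E]

/-- The average of `V` around `x` at scale `s`, weighted by the truncated paraboloid and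
normalised so that constants are their own average. -/
noncomputable def weightedMean (V : E → ℝ) (s : ℝ) (x : E) : ℝ :=
  (∫ y : E, truncParaboloid y)⁻¹ * ∫ y, V (x + s • y) * truncParaboloid y

lemma weightedMean_zero (V : E → ℝ) (x : E) : weightedMean V 0 x = V x := by
  simp [weightedMean, integral_const_mul, mul_left_comm _ (V x),
    integral_truncParaboloid_pos.ne']

/-- The radial derivative of the mean only involves the Laplacian: the divergence theorem turns
`⟪∇V, y⟫ (1 - ‖y‖²)₊` into `ΔV (1 - ‖y‖²)₊²`. -/
lemma hasDerivAt_weightedMean {V : E → ℝ} (hV : ContDiff ℝ 2 V) (x : E) (s : ℝ) :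
    HasDerivAt (fun s => weightedMean V s x)
      ((∫ y : E, truncParaboloid y)⁻¹ *
        (s / 4 * ∫ y, Δ V (x + s • y) * truncParaboloid y ^ 2)) s := by
  have hV1 := hV.of_le one_le_two
  have hV' := hV1.continuous_fderiv one_ne_zero
  obtain ⟨C, hC⟩ := (isCompact_closedBall x (|s| + 1)).exists_bound_of_continuousOn
    hV'.continuousOn
  have hbound (y : E) (r : ℝ) (hr : r ∈ Metric.ball s 1) :
      ‖fderiv ℝ V (x + r • y) y * truncParaboloid y‖ ≤ C * truncParaboloid y := by
    rw [norm_mul, Real.norm_of_nonneg (truncParaboloid_nonneg y)]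
    refine mul_truncParaboloid_le_mul (f := fun y => ‖fderiv ℝ V (x + r • y) y‖) fun hy => ?_
    have hr' : |r| ≤ |s| + 1 := by
      linarith [abs_sub_abs_le_abs_sub r s, Real.dist_eq r s ▸ Metric.mem_ball.1 hr]
    have hmem : x + r • y ∈ Metric.closedBall x (|s| + 1) := by
      rw [mem_closedBall_iff_norm, add_sub_cancel_left, norm_smul]
      exact (mul_le_of_le_one_right (abs_nonneg r) hy).trans hr'
    exact (ContinuousLinearMap.le_opNorm_of_le _ hy).trans (by simpa using hC _ hmem)
  have hgreen := integral_inner_mul_truncParaboloid_smul (F := fun y => ∇ V (x + s • y))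
    ((contDiff_gradient hV).comp (by fun_prop)) one_ne_zero
  simp only [divergence_comp_add_smul ((contDiff_gradient hV).differentiable one_ne_zero),
    divergence_gradient hV, inner_gradient_left, one_smul, mul_assoc s, integral_const_mul]
    at hgreen
  refine ((hasDerivAt_integral_comp_add_smul hV1 measurable_const measurable_id
    continuous_truncParaboloid.measurable s
    (integrable_mul_truncParaboloid (hV.continuous.comp (by fun_prop))) hbound
    (integrable_mul_truncParaboloid continuous_const)).const_mul _).congr_deriv ?_
  simp only [id_eq]
  congr 1
  linarith

lemma abs_weightedMean_sub_le {V : E → ℝ} (hV : ContDiff ℝ 2 V) {x : E} {s L : ℝ} (hs : 0 ≤ s)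
    (hL : ∀ z ∈ Metric.closedBall x s, |Δ V z| ≤ L) :
    |weightedMean V s x - V x| ≤ L * s ^ 2 := by
  have hL0 : 0 ≤ L := (abs_nonneg _).trans (hL x (Metric.mem_closedBall_self hs))
  have hderiv (r : ℝ) (hr : r ∈ Set.Icc 0 s) : ‖(∫ y : E, truncParaboloid y)⁻¹ *
      (r / 4 * ∫ y, Δ V (x + r • y) * truncParaboloid y ^ 2)‖ ≤ s * L := by
    have hle := norm_integral_mul_truncParaboloid_sq_le (f := fun y => Δ V (x + r • y))
      fun y hy => hL _ <| by
        rw [mem_closedBall_iff_norm, add_sub_cancel_left, norm_smul, Real.norm_of_nonneg hr.1]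
        exact (mul_le_of_le_one_right hr.1 hy).trans hr.2
    have hc := integral_truncParaboloid_pos (E := E)
    rw [norm_mul, norm_mul, norm_inv, Real.norm_of_nonneg hc.le,
      Real.norm_of_nonneg (by linarith [hr.1] : 0 ≤ r / 4), inv_mul_le_iff₀ hc]
    calc r / 4 * ‖∫ y, Δ V (x + r • y) * truncParaboloid y ^ 2‖
        ≤ s * (L * ∫ y : E, truncParaboloid y) := by
          gcongr
          linarith [hr.1, hr.2]
      _ = _ := by ring
  have h := (convex_Icc 0 s).norm_image_sub_le_of_norm_hasDerivWithin_le
    (fun r _ => (hasDerivAt_weightedMean hV x r).hasDerivWithinAt) hderiv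
    (Set.left_mem_Icc.2 hs) (Set.right_mem_Icc.2 hs)
  rw [weightedMean_zero, sub_zero, Real.norm_of_nonneg hs] at h
  exact h.trans_eq (by ring)

lemma weightedMean_eq_integral_comp_inv_smul {V : E → ℝ} {s : ℝ} (hs : 0 < s) (x : E) :
    weightedMean V s x = (∫ y : E, truncParaboloid y)⁻¹ * ((s ^ Module.finrank ℝ E)⁻¹ *
      ∫ z, V z * truncParaboloid (s⁻¹ • (z - x))) := by
  have h := Measure.integral_comp_smul (volume : Measure E)
    (fun y => V (x + y) * truncParaboloid (s⁻¹ • y)) s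
  simp only [inv_smul_smul₀ hs.ne'] at h
  rw [weightedMean, h, abs_of_pos (by positivity), smul_eq_mul,
    ← integral_add_left_eq_self (fun z => V z * truncParaboloid (s⁻¹ • (z - x))) x]
  simp only [add_sub_cancel_left]

lemma weightedMean_le_weightedMean_zero {U : E → ℝ} (hU : Continuous U) {R : ℝ} (hR : 0 < R)
    (hU0 : ∀ z ∈ Metric.closedBall 0 (4 * R), 0 ≤ U z) {x : E} (hx : ‖x‖ ≤ R) :
    weightedMean U R x ≤ 4 / 3 * 4 ^ Module.finrank ℝ E * weightedMean U (4 * R) 0 := by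
  have hR4 : 0 < 4 * R := by positivity
  have hint {s : ℝ} (hs : 0 < s) (x : E) :
      Integrable fun z => U z * truncParaboloid (s⁻¹ • (z - x)) :=
    (hU.mul (by fun_prop)).integrable_of_hasCompactSupport
      (((hasCompactSupport_truncParaboloid_smul (inv_ne_zero hs.ne')).comp_homeomorph
        (Homeomorph.subRight x)).mul_left)
  have hmono : ∫ z, U z * truncParaboloid (R⁻¹ • (z - x))
      ≤ 4 / 3 * ∫ z, U z * truncParaboloid ((4 * R)⁻¹ • (z - 0)) := by
    rw [← integral_const_mul]
    refine integral_mono (hint hR x) ((hint hR4 0).const_mul _) fun z => ?_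
    rcases le_total ‖z‖ (4 * R) with hz | hz
    · rw [sub_zero, mul_left_comm]
      exact mul_le_mul_of_nonneg_left (truncParaboloid_inv_smul_sub_le hR hx z)
        (hU0 z (by simpa using hz))
    · have hzero : truncParaboloid ((4 * R)⁻¹ • z) = 0 := truncParaboloid_eq_zero (by
        rwa [norm_smul, norm_inv, Real.norm_of_nonneg hR4.le, ← div_eq_inv_mul, one_le_div hR4])
      have hle := truncParaboloid_inv_smul_sub_le hR hx z
      rw [hzero, mul_zero] at hle
      simp only [sub_zero, hzero, hle.antisymm (truncParaboloid_nonneg _), mul_zero, le_refl]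
  rw [weightedMean_eq_integral_comp_inv_smul hR, weightedMean_eq_integral_comp_inv_smul hR4]
  have hc := integral_truncParaboloid_pos (E := E)
  calc _ ≤ (∫ y : E, truncParaboloid y)⁻¹ * ((R ^ Module.finrank ℝ E)⁻¹ *
        (4 / 3 * ∫ z, U z * truncParaboloid ((4 * R)⁻¹ • (z - 0)))) := by gcongr
    _ = _ := by rw [mul_pow]; field_simp

/-- The proof is the mean value property with error, used once at `x` and once at `0`, around the
comparison of the two means. -/
lemma le_of_nonneg_of_abs_laplacian_le {U : E → ℝ} (hU : ContDiff ℝ 2 U) {R L : ℝ} (hR : 0 < R)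
    (hU0 : ∀ z ∈ Metric.closedBall 0 (4 * R), 0 ≤ U z)
    (hL : ∀ z ∈ Metric.closedBall 0 (4 * R), |Δ U z| ≤ L) {x : E} (hx : ‖x‖ ≤ R) :
    U x ≤ 4 / 3 * 4 ^ Module.finrank ℝ E * (U 0 + L * (4 * R) ^ 2) + L * R ^ 2 := by
  have hsub : Metric.closedBall x R ⊆ Metric.closedBall 0 (4 * R) :=
    Metric.closedBall_subset_closedBall' (by rw [dist_zero_right]; linarith)
  have hmean_x := abs_le.1 (abs_weightedMean_sub_le hU hR.le fun z hz => hL z (hsub hz))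
  have hmean_zero := abs_le.1 (abs_weightedMean_sub_le hU (by positivity) hL)
  calc U x ≤ weightedMean U R x + L * R ^ 2 := by linarith [hmean_x.1]
    _ ≤ 4 / 3 * 4 ^ Module.finrank ℝ E * weightedMean U (4 * R) 0 + L * R ^ 2 := by
      gcongr
      exact weightedMean_le_weightedMean_zero hU.continuous hR hU0 hx
    _ ≤ _ := by
      gcongr
      linarith [hmean_zero.2]

lemma neg_integral_exp_le_weightedMean_one {V : E → ℝ} (hV : Continuous V)
    (hint : Integrable fun x => Real.exp (-V x)) (x : E) :
    -((∫ y : E, truncParaboloid y)⁻¹ * ∫ z, Real.exp (-V z)) ≤ weightedMean V 1 x := by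
  have hc := integral_truncParaboloid_pos (E := E)
  rw [weightedMean, ← mul_neg, ← integral_add_left_eq_self (fun z => Real.exp (-V z)) x,
    ← integral_neg]
  simp only [one_smul]
  gcongr
  · exact (hint.comp_add_left x).neg
  · exact integrable_mul_truncParaboloid (hV.comp (by fun_prop))
  · intro y
    have hexp := Real.add_one_le_exp (-V (x + y))
    have hpos := Real.exp_pos (-V (x + y))
    have hφ0 := truncParaboloid_nonneg y
    have hφ1 := truncParaboloid_le_one y
    beta_reduce
    nlinarith

lemma abs_weightedMean_one_sub_le {V : E → ℝ} (hV : Continuous V) {x h : E} {B : ℝ}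
    (hh : ‖h‖ ≤ 1) (hB : ∀ z ∈ Metric.closedBall x 2, |V z| ≤ B) :
    |weightedMean V 1 (x + h) - weightedMean V 1 x| ≤ (∫ y : E, truncParaboloid y)⁻¹ *
      ((volume : Measure E).real (Metric.closedBall 0 2) * (B * (2 * ‖h‖))) := by
  have hc := integral_truncParaboloid_pos (E := E)
  have hshift : weightedMean V 1 (x + h) =
      (∫ y : E, truncParaboloid y)⁻¹ * ∫ y, V (x + y) * truncParaboloid (y - h) := by
    rw [weightedMean, ← integral_sub_right_eq_self (fun y => V (x + h + (1 : ℝ) • y) * _) h]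
    simp only [one_smul, add_assoc, add_sub_cancel]
  have hint : Integrable fun y => V (x + y) * truncParaboloid (y - h) := by
    simpa [add_assoc] using (integrable_mul_truncParaboloid (f := fun y => V (x + h + y))
      (hV.comp (by fun_prop))).comp_sub_right h
  have hbound (y : E) : ‖V (x + y) * truncParaboloid (y - h) - V (x + y) * truncParaboloid y‖
      ≤ (Metric.closedBall (0 : E) 2).indicator (fun _ => B * (2 * ‖h‖)) y := by
    rw [← mul_sub, norm_mul]
    by_cases hy : y ∈ Metric.closedBall 0 2
    · rw [Set.indicator_of_mem hy]
      have hlip := lipschitzWith_truncParaboloid.dist_le_mul (y - h) y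
      rw [dist_eq_norm, dist_eq_norm, sub_sub_cancel_left, norm_neg] at hlip
      have hB' : ‖V (x + y)‖ ≤ B := hB _ (by simpa using hy)
      exact mul_le_mul hB' hlip (norm_nonneg _) ((norm_nonneg _).trans hB')
    · have hy' : 2 < ‖y‖ := by simpa using hy
      have hyh : 1 ≤ ‖y - h‖ := by linarith [norm_sub_norm_le y h]
      simp [hy, truncParaboloid_eq_zero hyh, truncParaboloid_eq_zero (by linarith : 1 ≤ ‖y‖)]
  rw [hshift, weightedMean, ← mul_sub, abs_mul, abs_of_pos (inv_pos.2 hc)]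
  simp only [one_smul]
  rw [← integral_sub hint (integrable_mul_truncParaboloid (f := fun y => V (x + y))
    (hV.comp (by fun_prop)))]
  gcongr
  refine (norm_integral_le_of_norm_le ?_ (.of_forall hbound)).trans_eq ?_
  · exact (integrable_indicator_iff measurableSet_closedBall).2
      (integrableOn_const (isCompact_closedBall _ _).measure_lt_top.ne)
  · rw [integral_indicator_const _ measurableSet_closedBall, smul_eq_mul]

end WeightedMean

section PolynomialGrowth

variable {E F G : Type*} [NormedAddCommGroup E] [NormedAddCommGroup F] [NormedAddCommGroup G]

/-- `f` is bounded by a power of `1 + ‖x‖`. Such functions are integrable against every Gaussian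
measure. -/
@[fun_prop]
def HasPolynomialGrowth (f : E → F) : Prop :=
  ∃ (C : ℝ) (n : ℕ), ∀ x, ‖f x‖ ≤ C * (1 + ‖x‖) ^ n

namespace HasPolynomialGrowth

lemma mono {f : E → F} {g : E → G} (hg : HasPolynomialGrowth g) (h : ∀ x, ‖f x‖ ≤ ‖g x‖) :
    HasPolynomialGrowth f := by
  obtain ⟨C, n, hC⟩ := hg
  exact ⟨C, n, fun x => (h x).trans (hC x)⟩

@[fun_prop]
lemma const (c : F) : HasPolynomialGrowth fun _ : E => c := ⟨‖c‖, 0, by simp⟩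

@[fun_prop]
lemma norm {f : E → F} (hf : HasPolynomialGrowth f) : HasPolynomialGrowth fun x => ‖f x‖ :=
  hf.mono fun x => by simp

@[fun_prop]
lemma add {f g : E → F} (hf : HasPolynomialGrowth f) (hg : HasPolynomialGrowth g) :
    HasPolynomialGrowth fun x => f x + g x := by
  obtain ⟨C, n, hC⟩ := hf
  obtain ⟨D, k, hD⟩ := hg
  refine ⟨|C| + |D|, max n k, fun x => (norm_add_le _ _).trans ?_⟩
  rw [add_mul]
  gcongr
  · exact (hC x).trans (by gcongr; exacts [le_abs_self C, by simp, le_max_left n k])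
  · exact (hD x).trans (by gcongr; exacts [le_abs_self D, by simp, le_max_right n k])

@[fun_prop]
lemma sub {f g : E → F} (hf : HasPolynomialGrowth f) (hg : HasPolynomialGrowth g) :
    HasPolynomialGrowth fun x => f x - g x :=
  (hf.norm.add hg.norm).mono fun _ => (norm_sub_le _ _).trans (le_abs_self _)

@[fun_prop]
lemma mul {f g : E → ℝ} (hf : HasPolynomialGrowth f) (hg : HasPolynomialGrowth g) :
    HasPolynomialGrowth fun x => f x * g x := by
  obtain ⟨C, n, hC⟩ := hf
  obtain ⟨D, k, hD⟩ := hg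
  refine ⟨C * D, n + k, fun x => ?_⟩
  rw [norm_mul, pow_add, mul_mul_mul_comm]
  exact mul_le_mul (hC x) (hD x) (norm_nonneg _) ((norm_nonneg _).trans (hC x))

@[fun_prop]
lemma pow {f : E → ℝ} (hf : HasPolynomialGrowth f) (n : ℕ) :
    HasPolynomialGrowth fun x => f x ^ n := by
  induction n with
  | zero => simpa using const (1 : ℝ)
  | succ n ih => simpa only [pow_succ] using ih.mul hf

@[fun_prop]
lemma id : HasPolynomialGrowth fun x : E => x := ⟨1, 1, fun x => by simp⟩

lemma comp {f : F → G} {g : E → F} (hf : HasPolynomialGrowth f) (hg : HasPolynomialGrowth g) :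
    HasPolynomialGrowth fun x => f (g x) := by
  obtain ⟨C, n, hC⟩ := hf
  have hbound : HasPolynomialGrowth fun x => C * (1 + ‖g x‖) ^ n := by fun_prop
  exact hbound.mono fun x => (hC (g x)).trans (le_abs_self _)

lemma exists_norm_le_of_norm_le {f : E → F} (hf : HasPolynomialGrowth f) :
    ∃ (C : ℝ) (n : ℕ), ∀ x t, ‖x‖ ≤ t → ‖f x‖ ≤ C * (1 + t) ^ n := by
  obtain ⟨C, n, hC⟩ := hf
  refine ⟨|C|, n, fun x t hx => (hC x).trans ?_⟩
  gcongr
  exact le_abs_self C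

lemma of_lipschitzWith {f : E → F} {K : ℝ≥0} (hf : LipschitzWith K f) : HasPolynomialGrowth f := by
  have hbound : HasPolynomialGrowth fun x : E => ‖f 0‖ + K * ‖x‖ := by fun_prop
  refine hbound.mono fun x => ?_
  have hlip := hf.norm_sub_le x 0
  rw [sub_zero] at hlip
  exact (by linarith [norm_le_norm_add_norm_sub' (f x) (f 0)] :
    ‖f x‖ ≤ ‖f 0‖ + K * ‖x‖).trans (le_abs_self _)

@[fun_prop]
lemma clm_apply [NormedSpace ℝ F] [NormedSpace ℝ G] {L : E → F →L[ℝ] G} {v : E → F}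
    (hL : HasPolynomialGrowth L) (hv : HasPolynomialGrowth v) :
    HasPolynomialGrowth fun x => L x (v x) :=
  (hL.norm.mul hv.norm).mono fun x => by simpa using (L x).le_opNorm (v x)

lemma integrable [NormedSpace ℝ E] [MeasurableSpace E] [BorelSpace E]
    [SecondCountableTopology E] [CompleteSpace E] {f : E → F} (hf : HasPolynomialGrowth f)
    {μ : Measure E} [IsGaussian μ] (hmeas : AEStronglyMeasurable f μ) :
    Integrable f μ := by
  obtain ⟨C, n, hC⟩ := hf
  have hmemLp : MemLp (fun x : E => 1 + ‖x‖) n μ :=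
    (memLp_const (1 : ℝ)).add (IsGaussian.memLp_id μ n (ENNReal.natCast_ne_top n)).norm
  refine (hmemLp.integrable_norm_pow'.const_mul C).mono' hmeas (.of_forall fun x => ?_)
  rw [Real.norm_of_nonneg (by positivity)]
  exact hC x

lemma memLp_two [NormedSpace ℝ E] [MeasurableSpace E] [BorelSpace E]
    [SecondCountableTopology E] [CompleteSpace E] {f : E → F} (hf : HasPolynomialGrowth f)
    {μ : Measure E} [IsGaussian μ] (hmeas : AEStronglyMeasurable f μ) :
    MemLp f 2 μ :=
  (memLp_two_iff_integrable_sq_norm hmeas).2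
    ((hf.norm.pow 2).integrable (hmeas.norm.pow 2))

end HasPolynomialGrowth

variable [InnerProductSpace ℝ E] [FiniteDimensional ℝ E] [MeasurableSpace E] [BorelSpace E]

theorem hasPolynomialGrowth_of_laplacian {V : E → ℝ} (hV : ContDiff ℝ 2 V)
    (hΔ : HasPolynomialGrowth (Δ V)) (hint : Integrable fun x => Real.exp (-V x)) :
    HasPolynomialGrowth V := by
  obtain ⟨C, n, hC⟩ := hΔ.exists_norm_le_of_norm_le
  set I := (∫ y : E, truncParaboloid y)⁻¹ * ∫ z, Real.exp (-V z)
  set K : ℝ := 4 / 3 * 4 ^ Module.finrank ℝ E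
  let L (x : E) : ℝ := C * (1 + (4 * (1 + ‖x‖) + 1)) ^ n
  have hL (x z : E) (hz : ‖z‖ ≤ 4 * (1 + ‖x‖) + 1) : |Δ V z| ≤ L x := hC z _ hz
  have hlower (x z : E) (hz : ‖z‖ ≤ 4 * (1 + ‖x‖)) : -(I + L x) ≤ V z := by
    have hmean := abs_weightedMean_sub_le hV (x := z) zero_le_one fun y hy => hL x y (by
      linarith [norm_le_norm_add_norm_sub' y z, mem_closedBall_iff_norm.1 hy])
    linarith [abs_le.1 hmean, neg_integral_exp_le_weightedMean_one hV.continuous hint z]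
  have hupper (x : E) : V x + (I + L x)
      ≤ K * (V 0 + (I + L x) + L x * (4 * (1 + ‖x‖)) ^ 2) + L x * (1 + ‖x‖) ^ 2 := by
    refine le_of_nonneg_of_abs_laplacian_le (U := fun z => V z + (I + L x))
      (hV.add contDiff_const) (by positivity) (fun z hz => ?_) (fun z hz => ?_) (by simp)
    · linarith [hlower x z (by simpa using hz)]
    · rw [show Δ (fun z => V z + (I + L x)) z = Δ V z from
        (hV.contDiffAt.laplacian_add contDiffAt_const).trans (by simp)]
      exact hL x z (by linarith [mem_closedBall_zero_iff.1 hz])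
  have hbound : HasPolynomialGrowth fun x =>
      K * (|V 0| + (I + L x) + L x * (4 * (1 + ‖x‖)) ^ 2) + L x * (1 + ‖x‖) ^ 2 + (I + L x) := by
    simp only [L]; fun_prop
  refine hbound.mono fun x => le_trans (abs_le.2 ?_) (le_abs_self _)
  have hI : 0 ≤ I := mul_nonneg (inv_nonneg.2 integral_truncParaboloid_pos.le) (by positivity)
  have hL0 : 0 ≤ L x := (abs_nonneg _).trans (hL x 0 (by rw [norm_zero]; positivity))
  have hlow := hlower x x (by linarith [norm_nonneg x])
  have hup : K * (V 0 + (I + L x) + L x * (4 * (1 + ‖x‖)) ^ 2)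
      ≤ K * (|V 0| + (I + L x) + L x * (4 * (1 + ‖x‖)) ^ 2) := by gcongr; exact le_abs_self _
  have hnonneg : 0 ≤ K * (|V 0| + (I + L x) + L x * (4 * (1 + ‖x‖)) ^ 2) + L x * (1 + ‖x‖) ^ 2 := by
    positivity
  constructor <;> linarith [hupper x]

lemma abs_weightedMean_one_sub_sub_le_of_lipschitzWith {V : E → ℝ} (hV : ContDiff ℝ 2 V) {ℓ : ℝ≥0}
    (hℓ : LipschitzWith ℓ (Δ V)) (x h : E) :
    |weightedMean V 1 (x + h) - weightedMean V 1 x - (V (x + h) - V x)| ≤ ℓ * ‖h‖ := by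
  let U : E → ℝ := fun z => V (z + h) - V z
  have hVh : ContDiff ℝ 2 fun z => V (z + h) := by fun_prop
  have hint (z : E) := integrable_mul_truncParaboloid (f := fun y => V (z + (1 : ℝ) • y))
    (hV.continuous.comp (by fun_prop))
  have hmean : weightedMean U 1 x = weightedMean V 1 (x + h) - weightedMean V 1 x := by
    simp only [weightedMean, ← mul_sub, ← integral_sub (hint (x + h)) (hint x), U, sub_mul,
      add_right_comm x _ h]
  have hΔ (z : E) : |Δ U z| ≤ ℓ * ‖h‖ := by
    have hΔ_shift : Δ (fun z => V (z + h)) z = Δ V (z + h) := by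
      simp only [InnerProductSpace.laplacian_eq_iteratedFDeriv_stdOrthonormalBasis,
        iteratedFDeriv_comp_add_right]
    rw [show Δ U z = _ from hVh.contDiffAt.laplacian_sub hV.contDiffAt, hΔ_shift]
    simpa using hℓ.norm_sub_le (z + h) z
  have hle := abs_weightedMean_sub_le (hVh.sub hV) (x := x) zero_le_one fun z _ => hΔ z
  rwa [one_pow, mul_one, show weightedMean (fun z => V (z + h) - V z) 1 x = _ from hmean] at hle

theorem hasPolynomialGrowth_fderiv_of_lipschitzWith_laplacian {V : E → ℝ} (hV : ContDiff ℝ 2 V)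
    {ℓ : ℝ≥0} (hℓ : LipschitzWith ℓ (Δ V)) (hgrowth : HasPolynomialGrowth V) :
    HasPolynomialGrowth (fderiv ℝ V) := by
  obtain ⟨C, n, hC⟩ := hgrowth.exists_norm_le_of_norm_le
  have hball (x z : E) (hz : z ∈ Metric.closedBall x 2) : |V z| ≤ C * (1 + (‖x‖ + 2)) ^ n :=
    hC z _ (by linarith [norm_le_norm_add_norm_sub' z x, mem_closedBall_iff_norm.1 hz])
  have hC0 : 0 ≤ C := by simpa using (norm_nonneg _).trans (hC 0 0 (by simp))
  let c := (∫ y : E, truncParaboloid y)⁻¹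
  have hc : 0 < c := inv_pos.2 integral_truncParaboloid_pos
  let v := (volume : Measure E).real (Metric.closedBall 0 2)
  have hbound : HasPolynomialGrowth fun x : E =>
      ℓ + c * (v * (C * (1 + (‖x‖ + 2)) ^ n * 2)) := by fun_prop
  refine hbound.mono fun x => ?_
  rw [Real.norm_of_nonneg (by positivity)]
  refine norm_fderiv_le_of_lip' ℝ (by positivity) ?_
  filter_upwards [Metric.closedBall_mem_nhds x one_pos] with z hz
  obtain ⟨h, rfl⟩ : ∃ h, z = x + h := ⟨z - x, by abel⟩
  rw [mem_closedBall_iff_norm, add_sub_cancel_left] at hz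
  have hshift := abs_weightedMean_one_sub_le hV.continuous hz (hball x)
  rw [add_sub_cancel_left]
  calc |V (x + h) - V x| ≤ ℓ * ‖h‖ + |weightedMean V 1 (x + h) - weightedMean V 1 x| := by
        have hdiff := abs_weightedMean_one_sub_sub_le_of_lipschitzWith hV hℓ x h
        rw [abs_sub_comm] at hdiff
        linarith [abs_sub_abs_le_abs_sub (V (x + h) - V x)
          (weightedMean V 1 (x + h) - weightedMean V 1 x)]
    _ ≤ (ℓ + c * (v * (C * (1 + (‖x‖ + 2)) ^ n * 2))) * ‖h‖ := by
        linarith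

end PolynomialGrowth

section DivergenceTheorem

variable {E : Type*} [NormedAddCommGroup E] [InnerProductSpace ℝ E] [FiniteDimensional ℝ E]
  [MeasurableSpace E] [BorelSpace E]

lemma tendsto_integral_mul_truncParaboloid_smul_pow {g : E → ℝ} (hg : Integrable g) (k : ℕ) :
    Filter.Tendsto (fun r : ℝ => ∫ y, g y * truncParaboloid (r • y) ^ k) (nhdsWithin 0 {0}ᶜ)
      (nhds (∫ y, g y)) := by
  refine tendsto_integral_filter_of_dominated_convergence (fun y => ‖g y‖) ?_ ?_ hg.norm ?_
  · exact .of_forall fun r =>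
      hg.aestronglyMeasurable.mul (Continuous.aestronglyMeasurable (by fun_prop))
  · refine .of_forall fun r => .of_forall fun y => ?_
    rw [norm_mul, norm_pow, Real.norm_of_nonneg (truncParaboloid_nonneg _)]
    exact mul_le_of_le_one_right (norm_nonneg _)
      (pow_le_one₀ (truncParaboloid_nonneg _) (truncParaboloid_le_one _))
  · refine .of_forall fun y => ?_
    have hcont : Continuous fun r : ℝ => g y * truncParaboloid (r • y) ^ k := by fun_prop
    simpa [truncParaboloid] using (hcont.tendsto 0).mono_left nhdsWithin_le_nhds

theorem integral_divergence_eq_zero {F : E → E} (hF : ContDiff ℝ 1 F)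
    (hinner : Integrable fun y => inner ℝ (F y) y) (hdiv : Integrable (divergence F)) :
    ∫ y, divergence F y = 0 := by
  have hsq : Filter.Tendsto (fun r : ℝ => 4 * r ^ 2) (nhdsWithin 0 {0}ᶜ) (nhds 0) := by
    simpa using ((by fun_prop : Continuous fun r : ℝ => 4 * r ^ 2).tendsto 0).mono_left
      nhdsWithin_le_nhds
  have hlhs := hsq.mul (tendsto_integral_mul_truncParaboloid_smul_pow hinner 1)
  rw [zero_mul] at hlhs
  refine tendsto_nhds_unique
    ((tendsto_integral_mul_truncParaboloid_smul_pow hdiv 2).congr' ?_) hlhs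
  filter_upwards [self_mem_nhdsWithin] with r hr
  simpa only [pow_one] using (integral_inner_mul_truncParaboloid_smul hF hr).symm

end DivergenceTheorem

section StdGaussian

variable {E : Type*} [NormedAddCommGroup E] [InnerProductSpace ℝ E]

lemma hasGradientAt_exp_neg_norm_sq_div_two [CompleteSpace E] (x : E) :
    HasGradientAt (fun x : E => Real.exp (-‖x‖ ^ 2 / 2)) (-Real.exp (-‖x‖ ^ 2 / 2) • x) x := by
  have hsq := (hasStrictFDerivAt_norm_sq x).hasFDerivAt.const_mul (-1 / 2 : ℝ)
  rw [hasGradientAt_iff_hasFDerivAt]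
  refine (hsq.exp.congr_fderiv ?_).congr_of_eventuallyEq (.of_forall fun y => by ring_nf)
  ext v
  simp only [InnerProductSpace.toDual_apply_apply, inner_smul_left, conj_trivial, smul_apply,
    innerSL_apply_apply, smul_eq_mul, nsmul_eq_mul]
  push_cast
  ring_nf

variable [FiniteDimensional ℝ E] [MeasurableSpace E] [BorelSpace E]

lemma integral_cexp_neg_norm_sq_div_two_add_inner_mul_I (t : E) :
    ∫ x : E, Complex.exp ((-‖x‖ ^ 2 / 2 : ℝ) + (inner ℝ x t : ℝ) * Complex.I)
      = (Real.pi / (1 / 2) : ℂ) ^ ((Module.finrank ℝ E : ℂ) / 2) * Complex.exp (-‖t‖ ^ 2 / 2) := by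
  convert GaussianFourier.integral_cexp_neg_mul_sq_norm_add (b := 1 / 2) (V := E)
    (by norm_num) Complex.I t using 2
  · ext x
    rw [real_inner_comm]
    push_cast
    ring_nf
  · rw [Complex.I_sq]
    ring_nf

lemma integrable_exp_neg_norm_sq_div_two :
    Integrable fun x : E => Real.exp (-‖x‖ ^ 2 / 2) := by
  refine (GaussianFourier.integrable_cexp_neg_mul_sq_norm_add (b := 1 / 2) (V := E)
    (by norm_num) 0 0).norm.congr (.of_forall fun x => ?_)
  simp [Complex.norm_exp, ← Complex.ofReal_pow]
  ring

theorem stdGaussian_eq_tilted :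
    stdGaussian E = (volume : Measure E).tilted fun x => -‖x‖ ^ 2 / 2 := by
  have := isProbabilityMeasure_tilted (integrable_exp_neg_norm_sq_div_two (E := E))
  have hZ : ((∫ x : E, Real.exp (-‖x‖ ^ 2 / 2) : ℝ) : ℂ)
      = (Real.pi / (1 / 2) : ℂ) ^ ((Module.finrank ℝ E : ℂ) / 2) := by
    simpa [← integral_complex_ofReal] using
      integral_cexp_neg_norm_sq_div_two_add_inner_mul_I (0 : E)
  have hZ0 : ((∫ x : E, Real.exp (-‖x‖ ^ 2 / 2) : ℝ) : ℂ) ≠ 0 :=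
    Complex.ofReal_ne_zero.2 (integral_exp_pos integrable_exp_neg_norm_sq_div_two).ne'
  refine Measure.ext_of_charFun (funext fun t => ?_)
  have hdensity (x : E) : (Real.exp (-‖x‖ ^ 2 / 2) / ∫ x : E, Real.exp (-‖x‖ ^ 2 / 2)) •
      Complex.exp ((inner ℝ x t : ℝ) * Complex.I)
      = ((∫ x : E, Real.exp (-‖x‖ ^ 2 / 2) : ℝ) : ℂ)⁻¹ *
        Complex.exp ((-‖x‖ ^ 2 / 2 : ℝ) + (inner ℝ x t : ℝ) * Complex.I) := by
    rw [Complex.exp_add, Complex.real_smul, Complex.ofReal_div, Complex.ofReal_exp]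
    ring
  rw [charFun_stdGaussian, charFun_apply, integral_tilted]
  simp_rw [hdensity]
  rw [integral_const_mul, integral_cexp_neg_norm_sq_div_two_add_inner_mul_I, ← hZ,
    inv_mul_cancel_left₀ hZ0]

theorem integral_inner_id_stdGaussian {F : E → E} (hF : ContDiff ℝ 1 F)
    (hinner : Integrable (fun z => inner ℝ (F z) z) (stdGaussian E))
    (hdiv : Integrable (divergence F) (stdGaussian E)) :
    ∫ z, inner ℝ (F z) z ∂(stdGaussian E) = ∫ z, divergence F z ∂(stdGaussian E) := by
  let ρ : E → ℝ := fun x => Real.exp (-‖x‖ ^ 2 / 2)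
  have hρ : ContDiff ℝ 1 ρ := ((contDiff_norm_sq ℝ).neg.div_const 2).exp
  have hdivergence (z : E) :
      divergence (fun x => ρ x • F x) z = ρ z * (divergence F z - inner ℝ (F z) z) := by
    rw [divergence_smul (hρ.differentiable one_ne_zero z) (hF.differentiable one_ne_zero z),
      (hasGradientAt_exp_neg_norm_sq_div_two z).hasFDerivAt.fderiv,
      InnerProductSpace.toDual_apply_apply, inner_smul_left, real_inner_comm, conj_trivial]
    ring
  rw [stdGaussian_eq_tilted] at hinner hdiv ⊢
  rw [eq_comm, ← sub_eq_zero, ← integral_sub hdiv hinner, integral_tilted]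
  rw [integrable_tilted_iff integrable_exp_neg_norm_sq_div_two] at hinner hdiv
  have hzero : ∫ z, ρ z * (divergence F z - inner ℝ (F z) z) = 0 := by
    simp only [← hdivergence]
    refine integral_divergence_eq_zero (hρ.smul hF) ?_ ?_
    · simpa only [real_inner_smul_left, smul_eq_mul, ρ] using hinner
    · simp only [funext hdivergence, mul_sub]
      exact hdiv.sub hinner
  simp only [smul_eq_mul, div_mul_eq_mul_div, integral_div]
  rw [hzero, zero_div]

end StdGaussian

section KullbackLeibler

open InformationTheory

lemma klDiv_map_measurableEquiv {α β : Type*} [MeasurableSpace α] [MeasurableSpace β]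
    (μ ν : Measure α) [IsFiniteMeasure μ] [IsFiniteMeasure ν] (e : α ≃ᵐ β) :
    klDiv (μ.map e) (ν.map e) = klDiv μ ν := by
  refine le_antisymm (klDiv_map_le _ _ e.measurable) ?_
  simpa using klDiv_map_le (μ.map e) (ν.map e) e.symm.measurable

lemma tilted_map_measurableEquiv {α β : Type*} [MeasurableSpace α] [MeasurableSpace β]
    (μ : Measure α) (e : α ≃ᵐ β) (f : β → ℝ) :
    (μ.map e).tilted f = (μ.tilted (f ∘ e)).map e := by
  ext s hs
  rw [tilted_apply' _ _ hs, e.map_apply, tilted_apply' _ _ (e.measurable hs),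
    integral_map_equiv, e.restrict_map, lintegral_map_equiv]
  rfl

lemma smul_tilted {α : Type*} [MeasurableSpace α] (μ : Measure α) {c : ℝ≥0∞} (hc : c ≠ 0)
    (hc' : c ≠ ∞) (f : α → ℝ) : (c • μ).tilted f = μ.tilted f := by
  ext s hs
  have h (x : α) : ENNReal.ofReal (Real.exp (f x) / (c.toReal * ∫ x, Real.exp (f x) ∂μ))
      = c⁻¹ * ENNReal.ofReal (Real.exp (f x) / ∫ x, Real.exp (f x) ∂μ) := by
    rw [mul_comm c.toReal, ← div_div, div_eq_inv_mul, ENNReal.ofReal_mul (by positivity),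
      ENNReal.ofReal_inv_of_pos (ENNReal.toReal_pos hc hc'), ENNReal.ofReal_toReal hc']
  simp only [tilted_apply' _ _ hs, integral_smul_measure, smul_eq_mul, h,
    Measure.restrict_smul, lintegral_smul_measure]
  rw [lintegral_const_mul' _ _ (ENNReal.inv_ne_top.2 hc), ← mul_assoc,
    ENNReal.mul_inv_cancel hc hc', one_mul]

lemma klDiv_tilted_ne_top_and_toReal_klDiv_tilted {α : Type*} [MeasurableSpace α] {ν : Measure α}
    [SigmaFinite ν] [NeZero ν] {f g : α → ℝ} (hf : Integrable (fun x => Real.exp (f x)) ν)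
    (hg : Integrable (fun x => Real.exp (g x)) ν) (hfi : Integrable f (ν.tilted f))
    (hgi : Integrable g (ν.tilted f)) :
    klDiv (ν.tilted f) (ν.tilted g) ≠ ∞ ∧ (klDiv (ν.tilted f) (ν.tilted g)).toReal
      = ∫ x, f x ∂(ν.tilted f) - Real.log (∫ x, Real.exp (f x) ∂ν) - ∫ x, g x ∂(ν.tilted f)
        + Real.log (∫ x, Real.exp (g x) ∂ν) := by
  have := isProbabilityMeasure_tilted hf
  have := isProbabilityMeasure_tilted hg
  have hac : ν.tilted f ≪ ν := tilted_absolutelyContinuous ν f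
  have hac_tilted : ν.tilted f ≪ ν.tilted g := hac.trans (absolutelyContinuous_tilted hg)
  have hllr : llr (ν.tilted f) ν =ᵐ[ν.tilted f]
      fun x => f x - Real.log (∫ x, Real.exp (f x) ∂ν) :=
    hac.ae_le (log_rnDeriv_tilted_left_self hf)
  have hllr_int : Integrable (llr (ν.tilted f) ν) (ν.tilted f) :=
    (integrable_congr hllr).2 (hfi.sub (integrable_const _))
  have hllr_tilted_int := integrable_llr_tilted_right hac hgi hllr_int hg
  refine ⟨klDiv_ne_top hac_tilted hllr_tilted_int, ?_⟩
  rw [toReal_klDiv hac_tilted hllr_tilted_int, integral_llr_tilted_right hac hgi hg hllr_int,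
    integral_congr_ae hllr, integral_sub hfi (integrable_const _)]
  simp

variable {E : Type*} [NormedAddCommGroup E] [InnerProductSpace ℝ E] [FiniteDimensional ℝ E]
  [MeasurableSpace E] [BorelSpace E]

lemma map_add_clm_volume (m : E) {A : E →L[ℝ] E} (hA : A.det ≠ 0) :
    (volume : Measure E).map (fun z => m + A z) = ENNReal.ofReal |A.det⁻¹| • volume := by
  rw [show (fun z => m + A z) = (fun x => m + x) ∘ A from rfl,
    ← Measure.map_map (by fun_prop) (by fun_prop),
    show (volume : Measure E).map A = _ from Measure.map_linearMap_addHaar_eq_smul_addHaar _ hA,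
    Measure.map_smul, map_add_left_eq_self]

/-- Pulling the affine map back to the target turns it into a change of variables in the
normalising constant of `exp (-V)`. -/
theorem exists_klDiv_map_stdGaussian_ne_top_and_toReal_eq {V : E → ℝ} (hV : Continuous V)
    (hgrowth : HasPolynomialGrowth V) (hint : Integrable fun x => Real.exp (-V x)) :
    ∃ a : ℝ, ∀ (m : E) (A : E →L[ℝ] E), A.det ≠ 0 →
      klDiv ((stdGaussian E).map fun z => m + A z) ((volume : Measure E).tilted fun x => -V x) ≠ ∞ ∧
      (klDiv ((stdGaussian E).map fun z => m + A z)
        ((volume : Measure E).tilted fun x => -V x)).toReal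
        = a + ∫ z, V (m + A z) ∂(stdGaussian E) - Real.log |A.det| := by
  refine ⟨∫ z, -‖z‖ ^ 2 / 2 ∂(stdGaussian E) - Real.log (∫ x : E, Real.exp (-‖x‖ ^ 2 / 2))
    + Real.log (∫ x, Real.exp (-V x)), fun m A hA => ?_⟩
  let e : E ≃ᵐ E := ((A.toContinuousLinearEquivOfDetNeZero hA).toHomeomorph.trans
    (Homeomorph.addLeft m)).toMeasurableEquiv
  have hmap : (volume : Measure E).map e = ENNReal.ofReal |A.det⁻¹| • volume :=
    map_add_clm_volume m hA
  have hc : ENNReal.ofReal |A.det⁻¹| ≠ 0 := by simpa using hA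
  have htarget : (volume : Measure E).tilted (fun x => -V x)
      = ((volume : Measure E).tilted fun z => -V (m + A z)).map e := by
    rw [← smul_tilted _ hc ENNReal.ofReal_ne_top, ← hmap, tilted_map_measurableEquiv]
    rfl
  have hnorm : ∫ z, Real.exp (-V (m + A z)) = |A.det|⁻¹ * ∫ x, Real.exp (-V x) := by
    rw [← abs_inv, ← ENNReal.toReal_ofReal (abs_nonneg A.det⁻¹), ← smul_eq_mul,
      ← integral_smul_measure, ← hmap, integral_map_equiv]
    rfl
  have hintA : Integrable fun z => Real.exp (-V (m + A z)) :=
    (integrable_map_equiv e fun x => Real.exp (-V x)).1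
      (hmap ▸ hint.smul_measure ENNReal.ofReal_ne_top)
  have := isProbabilityMeasure_tilted hintA
  have hV_int : Integrable (fun z => -V (m + A z)) (stdGaussian E) :=
    ((hgrowth.comp (by fun_prop)).integrable (Continuous.aestronglyMeasurable (by fun_prop))).neg
  have hsq_int : Integrable (fun z : E => -‖z‖ ^ 2 / 2) (stdGaussian E) :=
    ((by fun_prop : HasPolynomialGrowth fun z : E => ‖z‖ ^ 2).integrable
      (Continuous.aestronglyMeasurable (by fun_prop))).neg.div_const 2
  rw [htarget, show (stdGaussian E).map (fun z => m + A z) = (stdGaussian E).map e from rfl,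
    klDiv_map_measurableEquiv]
  rw [stdGaussian_eq_tilted] at hV_int hsq_int ⊢
  obtain ⟨hne_top, htoReal⟩ := klDiv_tilted_ne_top_and_toReal_klDiv_tilted
    integrable_exp_neg_norm_sq_div_two hintA hsq_int hV_int
  refine ⟨hne_top, ?_⟩
  rw [htoReal, hnorm, integral_neg, Real.log_mul (by simpa using hA) (integral_exp_pos hint).ne',
    Real.log_inv]
  ring

end KullbackLeibler

section MultivariateGaussian

open scoped MatrixOrder

variable {ι : Type*} [Fintype ι] [DecidableEq ι]

lemma adjoint_toEuclideanCLM (M : Matrix ι ι ℝ) :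
    ContinuousLinearMap.adjoint (Matrix.toEuclideanCLM (𝕜 := ℝ) M)
      = Matrix.toEuclideanCLM (𝕜 := ℝ) M.transpose := by
  rw [← ContinuousLinearMap.star_eq_adjoint, ← map_star, Matrix.star_eq_conjTranspose,
    Matrix.conjTranspose_eq_transpose_of_trivial]

lemma det_toEuclideanCLM (M : Matrix ι ι ℝ) :
    (Matrix.toEuclideanCLM (𝕜 := ℝ) M).det = M.det :=
  LinearMap.det_toLpLin 2 M

lemma trace_toEuclideanCLM (M : Matrix ι ι ℝ) :
    LinearMap.trace ℝ (EuclideanSpace ℝ ι) (Matrix.toEuclideanCLM (𝕜 := ℝ) M) = M.trace := by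
  rw [LinearMap.trace_eq_sum_inner _ (EuclideanSpace.basisFun ι ℝ)]
  simp [Matrix.trace, Matrix.inner_toEuclideanCLM, EuclideanSpace.basisFun_apply]

theorem stdGaussian_map_add_toEuclideanCLM (m : EuclideanSpace ℝ ι) (M : Matrix ι ι ℝ) :
    (stdGaussian (EuclideanSpace ℝ ι)).map (fun z => m + Matrix.toEuclideanCLM (𝕜 := ℝ) M z)
      = multivariateGaussian m (M * M.transpose) := by
  have hM : (M * M.transpose).PosSemidef := by
    simpa using Matrix.posSemidef_self_mul_conjTranspose M
  have : IsProbabilityMeasure ((stdGaussian (EuclideanSpace ℝ ι)).map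
      fun z => m + Matrix.toEuclideanCLM (𝕜 := ℝ) M z) :=
    Measure.isProbabilityMeasure_map (Measurable.aemeasurable (by fun_prop))
  refine Measure.ext_of_charFun (funext fun t => ?_)
  have hnorm : ‖ContinuousLinearMap.adjoint (Matrix.toEuclideanCLM (𝕜 := ℝ) M) t‖ ^ 2
      = t.ofLp ⬝ᵥ (M * M.transpose).mulVec t.ofLp := by
    rw [← real_inner_self_eq_norm_sq, ContinuousLinearMap.adjoint_inner_left,
      adjoint_toEuclideanCLM, ← mul_apply_eq_comp, ← map_mul, Matrix.inner_toEuclideanCLM]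
  rw [charFun_multivariateGaussian hM, ← hnorm]
  calc charFun ((stdGaussian (EuclideanSpace ℝ ι)).map
        fun z => m + Matrix.toEuclideanCLM (𝕜 := ℝ) M z) t
      = charFun (stdGaussian (EuclideanSpace ℝ ι))
          (ContinuousLinearMap.adjoint (Matrix.toEuclideanCLM (𝕜 := ℝ) M) t)
        * Complex.exp (inner ℝ m t * Complex.I) := by
        rw [charFun_apply, charFun_apply, integral_map (Measurable.aemeasurable (by fun_prop))
          (by fun_prop), ← integral_mul_const]
        simp only [inner_add_left, ContinuousLinearMap.adjoint_inner_right, ← Complex.exp_add]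
        congr with z
        push_cast
        ring_nf
    _ = _ := by
        rw [charFun_stdGaussian, ← Complex.exp_add, real_inner_comm]
        push_cast
        ring_nf

lemma isUnit_det_sqrt {S : Matrix ι ι ℝ} (hS : S.PosDef) : IsUnit (CFC.sqrt S).det := by
  have hdet : (CFC.sqrt S).det * (CFC.sqrt S).det = S.det := by
    rw [← Matrix.det_mul, CFC.sqrt_mul_sqrt_self S hS.posSemidef.nonneg]
  exact isUnit_of_mul_isUnit_left (hdet ▸ hS.det_pos.ne'.isUnit)

lemma inv_mul_sqrt {S : Matrix ι ι ℝ} (hS : S.PosDef) :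
    S⁻¹ * CFC.sqrt S = (CFC.sqrt S)⁻¹ := by
  conv_lhs => rw [← CFC.sqrt_mul_sqrt_self S hS.posSemidef.nonneg, Matrix.mul_inv_rev]
  rw [CFC.sqrt_mul_sqrt_self S hS.posSemidef.nonneg, mul_assoc,
    Matrix.nonsing_inv_mul _ (isUnit_det_sqrt hS), mul_one]

lemma transpose_sqrt (S : Matrix ι ι ℝ) : (CFC.sqrt S).transpose = CFC.sqrt S := by
  rw [← Matrix.conjTranspose_eq_transpose_of_trivial]
  exact (CFC.sqrt_nonneg S).isSelfAdjoint

lemma integral_multivariateGaussian {F : Type*} [NormedAddCommGroup F] [NormedSpace ℝ F]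
    {f : EuclideanSpace ℝ ι → F} (hf : Continuous f) (m : EuclideanSpace ℝ ι)
    (S : Matrix ι ι ℝ) :
    ∫ x, f x ∂(multivariateGaussian m S)
      = ∫ z, f (m + Matrix.toEuclideanCLM (𝕜 := ℝ) (CFC.sqrt S) z)
        ∂(stdGaussian (EuclideanSpace ℝ ι)) :=
  integral_map (Measurable.aemeasurable (by fun_prop)) (hf.aestronglyMeasurable)

theorem integral_inner_toEuclideanCLM_inv_sub_multivariateGaussian {S : Matrix ι ι ℝ}
    (hS : S.PosDef) (m : EuclideanSpace ℝ ι) {F : EuclideanSpace ℝ ι → EuclideanSpace ℝ ι}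
    (hF : ContDiff ℝ 1 F)
    (hinner : Integrable (fun x => inner ℝ (F x) (Matrix.toEuclideanCLM (𝕜 := ℝ) S⁻¹ (x - m)))
      (multivariateGaussian m S))
    (hdiv : Integrable (divergence F) (multivariateGaussian m S)) :
    ∫ x, inner ℝ (F x) (Matrix.toEuclideanCLM (𝕜 := ℝ) S⁻¹ (x - m)) ∂(multivariateGaussian m S)
      = ∫ x, divergence F x ∂(multivariateGaussian m S) := by
  set A := Matrix.toEuclideanCLM (𝕜 := ℝ) (CFC.sqrt S)
  set B := Matrix.toEuclideanCLM (𝕜 := ℝ) (CFC.sqrt S)⁻¹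
  have hAB : A ∘L B = .id ℝ _ := by
    rw [← ContinuousLinearMap.mul_def, ← map_mul,
      Matrix.mul_nonsing_inv _ (isUnit_det_sqrt hS), map_one]
    rfl
  have hscore (z) : inner ℝ (F (m + A z)) (Matrix.toEuclideanCLM (𝕜 := ℝ) S⁻¹ (m + A z - m))
      = inner ℝ (B (F (m + A z))) z := by
    rw [add_sub_cancel_left, ← mul_apply_eq_comp, ← map_mul, inv_mul_sqrt hS,
      ← ContinuousLinearMap.adjoint_inner_left, adjoint_toEuclideanCLM,
      Matrix.transpose_nonsing_inv, transpose_sqrt]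
  have hdivergence (z) : divergence (fun z => B (F (m + A z))) z = divergence F (m + A z) :=
    divergence_clm_comp_comp_add_clm hAB (hF.differentiable one_ne_zero) m z
  have hmap : AEMeasurable (fun z => m + A z) (stdGaussian (EuclideanSpace ℝ ι)) :=
    Measurable.aemeasurable (by fun_prop)
  have hinner' := hinner.comp_aemeasurable hmap
  have hdiv' := hdiv.comp_aemeasurable hmap
  simp only [Function.comp_def, A, hscore, ← hdivergence] at hinner' hdiv'
  have hF_cont := hF.continuous
  rw [integral_multivariateGaussian (by fun_prop),
    integral_multivariateGaussian (continuous_divergence hF)]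
  simp only [A, hscore, ← hdivergence]
  exact integral_inner_id_stdGaussian (B.contDiff.comp (hF.comp (by fun_prop))) hinner' hdiv'

lemma integral_norm_sq_toEuclideanCLM_inv_sub_multivariateGaussian {S : Matrix ι ι ℝ}
    (hS : S.PosDef) (m : EuclideanSpace ℝ ι) :
    ∫ x, ‖Matrix.toEuclideanCLM (𝕜 := ℝ) S⁻¹ (x - m)‖ ^ 2 ∂(multivariateGaussian m S)
      = (S⁻¹).trace := by
  have hdiv : divergence (fun x => Matrix.toEuclideanCLM (𝕜 := ℝ) S⁻¹ (x - m))
      = fun _ => (S⁻¹).trace := by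
    ext x
    rw [divergence_clm_sub, trace_toEuclideanCLM]
  have hgrowth :
      HasPolynomialGrowth fun x => ‖Matrix.toEuclideanCLM (𝕜 := ℝ) S⁻¹ (x - m)‖ ^ 2 := by
    fun_prop
  have stein := integral_inner_toEuclideanCLM_inv_sub_multivariateGaussian hS m
    (F := fun x => Matrix.toEuclideanCLM (𝕜 := ℝ) S⁻¹ (x - m)) (by fun_prop)
    (by
      simp only [real_inner_self_eq_norm_sq]
      exact hgrowth.integrable (Continuous.aestronglyMeasurable (by fun_prop)))
    (hdiv ▸ integrable_const _)
  simpa only [real_inner_self_eq_norm_sq, hdiv, integral_const, probReal_univ, one_smul]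
    using stein

lemma integral_toEuclideanCLM_inv_sub_multivariateGaussian (S : Matrix ι ι ℝ)
    (m : EuclideanSpace ℝ ι) :
    ∫ x, Matrix.toEuclideanCLM (𝕜 := ℝ) S⁻¹ (x - m) ∂(multivariateGaussian m S) = 0 := by
  have hid : Integrable (fun x => x) (multivariateGaussian m S) := IsGaussian.integrable_id
  have hsub : Integrable (fun x => x - m) (multivariateGaussian m S) :=
    hid.sub (integrable_const m)
  rw [ContinuousLinearMap.integral_comp_comm _ hsub, integral_sub hid (integrable_const m)]
  simp

end MultivariateGaussian

section Optimality

open scoped MatrixOrder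

lemma hasDerivAt_log_abs_det_one_add_smul {ι : Type*} [Fintype ι] [DecidableEq ι]
    (M : Matrix ι ι ℝ) :
    HasDerivAt (fun s : ℝ => Real.log |(1 + s • M).det|) M.trace 0 := by
  have hdet : HasDerivAt (fun s : ℝ => (1 + s • M).det) M.trace 0 := by
    rw [funext fun s => Matrix.det_one_add_smul s M]
    have hlinear := ((hasDerivAt_id (0 : ℝ)).const_mul M.trace).const_add 1
    have hquadratic :=
      ((1 + (Polynomial.X : Polynomial ℝ) • M.map Polynomial.C).det.divX.divX.hasDerivAt
        (0 : ℝ)).mul (hasDerivAt_pow 2 (0 : ℝ))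
    exact (hlinear.add hquadratic).congr_deriv (by simp)
  simpa using hdet.log (by simp)

lemma hasDerivAt_integral_comp_add_clm_add_smul {E : Type*} [NormedAddCommGroup E]
    [InnerProductSpace ℝ E] [FiniteDimensional ℝ E] [MeasurableSpace E] [BorelSpace E]
    {γ : Measure E} [IsGaussian γ] {V : E → ℝ} (hV : ContDiff ℝ 1 V)
    (hgrowth : HasPolynomialGrowth V) (hgrowth' : HasPolynomialGrowth (fderiv ℝ V))
    (m : E) (A B : E →L[ℝ] E) :
    HasDerivAt (fun s : ℝ => ∫ z, V (m + A z + s • B z) ∂γ)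
      (∫ z, fderiv ℝ V (m + A z) (B z) ∂γ) 0 := by
  obtain ⟨C, n, hC⟩ := hgrowth'.exists_norm_le_of_norm_le
  have hbound_growth :
      HasPolynomialGrowth fun z => C * (1 + (‖m + A z‖ + ‖B z‖)) ^ n * ‖B z‖ := by
    fun_prop
  have hV_cont := hV.continuous
  have hderiv := hasDerivAt_integral_comp_add_smul (ν := γ) hV (p := fun z => m + A z)
    (q := fun z => B z) (w := fun _ => 1)
    (bound := fun z => C * (1 + (‖m + A z‖ + ‖B z‖)) ^ n * ‖B z‖)
    (by fun_prop) (by fun_prop) (by fun_prop) 0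
    (by
      simpa using (hgrowth.comp (by fun_prop)).integrable
        (Continuous.aestronglyMeasurable (by fun_prop)))
    (fun z r hr => ?_)
    (hbound_growth.integrable (Continuous.aestronglyMeasurable (by fun_prop)))
  · simpa using hderiv
  · have hr : ‖r‖ ≤ 1 := (mem_ball_zero_iff.1 hr).le
    have harg : ‖m + A z + r • B z‖ ≤ ‖m + A z‖ + ‖B z‖ := by
      refine (norm_add_le _ _).trans ?_
      gcongr
      rw [norm_smul]
      exact mul_le_of_le_one_left (norm_nonneg _) hr
    rw [mul_one]
    exact (ContinuousLinearMap.le_opNorm _ _).trans (by gcongr; exact hC _ _ harg)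

variable {d : ℕ}

lemma stdGaussian_map_add_toEuclideanCLM_mem_buresWasserstein
    (m : EuclideanSpace ℝ (Fin d)) {M : Matrix (Fin d) (Fin d) ℝ} (hM : M.det ≠ 0) :
    (stdGaussian (EuclideanSpace ℝ (Fin d))).map
      (fun z => m + Matrix.toEuclideanCLM (𝕜 := ℝ) M z) ∈ buresWasserstein d := by
  refine ⟨m, M * M.transpose, ?_, stdGaussian_map_add_toEuclideanCLM m M⟩
  simpa using Matrix.PosDef.mul_conjTranspose_self M (Matrix.vecMul_injective_of_isUnit
    ((Matrix.isUnit_iff_isUnit_det M).2 hM.isUnit))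

namespace IsOptimalGaussian

variable {V : EuclideanSpace ℝ (Fin d) → ℝ} {m : EuclideanSpace ℝ (Fin d)}
  {S : Matrix (Fin d) (Fin d) ℝ}

lemma integral_sub_log_abs_det_le (hopt : IsOptimalGaussian V (multivariateGaussian m S))
    (hS : S.PosDef) (hV : Continuous V) (hgrowth : HasPolynomialGrowth V)
    (hint : Integrable fun x => Real.exp (-V x)) {M : Matrix (Fin d) (Fin d) ℝ} (hM : M.det ≠ 0) :
    ∫ z, V (m + Matrix.toEuclideanCLM (𝕜 := ℝ) (CFC.sqrt S) z)
        ∂(stdGaussian (EuclideanSpace ℝ (Fin d))) - Real.log |(CFC.sqrt S).det|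
      ≤ ∫ z, V (m + Matrix.toEuclideanCLM (𝕜 := ℝ) M z)
        ∂(stdGaussian (EuclideanSpace ℝ (Fin d))) - Real.log |M.det| := by
  obtain ⟨a, ha⟩ := exists_klDiv_map_stdGaussian_ne_top_and_toReal_eq hV hgrowth hint
  have hR := ha m (Matrix.toEuclideanCLM (𝕜 := ℝ) (CFC.sqrt S))
    (by simpa only [det_toEuclideanCLM] using (isUnit_det_sqrt hS).ne_zero)
  have hM' := ha m (Matrix.toEuclideanCLM (𝕜 := ℝ) M) (by rwa [det_toEuclideanCLM])
  have hle := ENNReal.toReal_mono hM'.1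
    (hopt.2 (stdGaussian_map_add_toEuclideanCLM_mem_buresWasserstein m hM))
  rw [targetMeasure, hM'.2, multivariateGaussian, hR.2, det_toEuclideanCLM,
    det_toEuclideanCLM] at hle
  linarith

/-- The stationarity condition of the curve `s ↦ N(m, (1 + s K) S (1 + s K)ᵀ)`. -/
theorem integral_fderiv_toEuclideanCLM_sub_eq_trace
    (hopt : IsOptimalGaussian V (multivariateGaussian m S)) (hS : S.PosDef)
    (hV : ContDiff ℝ 1 V) (hgrowth : HasPolynomialGrowth V)
    (hgrowth' : HasPolynomialGrowth (fderiv ℝ V)) (hint : Integrable fun x => Real.exp (-V x))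
    (K : Matrix (Fin d) (Fin d) ℝ) :
    ∫ x, fderiv ℝ V x (Matrix.toEuclideanCLM (𝕜 := ℝ) K (x - m)) ∂(multivariateGaussian m S)
      = K.trace := by
  set R := CFC.sqrt S
  have hR_det : R.det ≠ 0 := (isUnit_det_sqrt hS).ne_zero
  have hpath (s : ℝ) (z : EuclideanSpace ℝ (Fin d)) :
      Matrix.toEuclideanCLM (𝕜 := ℝ) ((1 + s • K) * R) z
        = Matrix.toEuclideanCLM (𝕜 := ℝ) R z + s • Matrix.toEuclideanCLM (𝕜 := ℝ) (K * R) z := by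
    simp [add_mul]
  have hderiv := (hasDerivAt_integral_comp_add_clm_add_smul
    (γ := stdGaussian (EuclideanSpace ℝ (Fin d))) hV hgrowth hgrowth' m
    (Matrix.toEuclideanCLM (𝕜 := ℝ) R) (Matrix.toEuclideanCLM (𝕜 := ℝ) (K * R))).sub
    (hasDerivAt_log_abs_det_one_add_smul K)
  have hdet_near : ∀ᶠ s : ℝ in nhds 0, (1 + s • K).det ≠ 0 :=
    (Continuous.continuousAt (by fun_prop)).eventually_ne (by simp)
  have hmin : IsLocalMin (fun s : ℝ => ∫ z, V (m + Matrix.toEuclideanCLM (𝕜 := ℝ) R z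
      + s • Matrix.toEuclideanCLM (𝕜 := ℝ) (K * R) z) ∂(stdGaussian (EuclideanSpace ℝ (Fin d)))
      - Real.log |(1 + s • K).det|) 0 := by
    filter_upwards [hdet_near] with s hs
    have hle := hopt.integral_sub_log_abs_det_le hS hV.continuous hgrowth hint
      (M := (1 + s • K) * R) (by rw [Matrix.det_mul]; exact mul_ne_zero hs hR_det)
    rw [Matrix.det_mul, abs_mul, Real.log_mul (by simpa using hs) (by simpa using hR_det)] at hle
    simp only [hpath, ← add_assoc] at hle
    simp only [zero_smul, add_zero, Matrix.det_one, abs_one, Real.log_one, sub_zero]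
    linarith
  have hV' := hV.continuous_fderiv one_ne_zero
  rw [integral_multivariateGaussian (by fun_prop)]
  simp only [add_sub_cancel_left, ← mul_apply_eq_comp, ← map_mul]
  exact sub_eq_zero.1 (hmin.hasDerivAt_eq_zero hderiv)

end IsOptimalGaussian

end Optimality

section Wasserstein

lemma sq_eLpNorm_two {α F : Type*} [MeasurableSpace α] [NormedAddCommGroup F] (f : α → F)
    (μ : Measure α) : eLpNorm f 2 μ ^ 2 = ∫⁻ x, ‖f x‖ₑ ^ 2 ∂μ := by
  simpa using eLpNorm_nnreal_pow_eq_lintegral (f := f) (μ := μ) (p := 2) two_ne_zero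

lemma enorm_integral_le_eLpNorm_two {α F : Type*} [MeasurableSpace α]
    [NormedAddCommGroup F] [NormedSpace ℝ F] {μ : Measure α} [IsProbabilityMeasure μ] {f : α → F}
    (hf : AEStronglyMeasurable f μ) : ‖∫ x, f x ∂μ‖ₑ ≤ eLpNorm f 2 μ :=
  calc ‖∫ x, f x ∂μ‖ₑ ≤ eLpNorm f 1 μ := by
        rw [eLpNorm_one_eq_lintegral_enorm]
        exact enorm_integral_le_lintegral_enorm f
    _ ≤ eLpNorm f 2 μ := eLpNorm_le_eLpNorm_of_exponent_le one_le_two hf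

variable {E : Type*} [MeasurableSpace E]

lemma prod_mem_transportPlans (μ ν : Measure E) [IsProbabilityMeasure μ]
    [IsProbabilityMeasure ν] : μ.prod ν ∈ transportPlans μ ν :=
  ⟨Measure.fst_prod, Measure.snd_prod⟩

variable [NormedAddCommGroup E]

lemma sq_W₂ (μ ν : Measure E) : W₂ μ ν ^ 2 = (wassersteinSq μ ν).toReal :=
  Real.sq_sqrt ENNReal.toReal_nonneg

variable {μ ν : Measure E} [IsProbabilityMeasure μ]

lemma wassersteinSq_ne_top [SecondCountableTopology E] [IsProbabilityMeasure ν]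
    (hμ : MemLp (fun x => x) 2 μ) (hν : MemLp (fun x => x) 2 ν) : wassersteinSq μ ν ≠ ∞ := by
  have hdiff : MemLp (fun p : E × E => p.1 - p.2) 2 (μ.prod ν) :=
    (hμ.comp_measurePreserving measurePreserving_fst).sub
      (hν.comp_measurePreserving measurePreserving_snd)
  refine ne_top_of_le_ne_top ?_ (iInf₂_le _ (prod_mem_transportPlans μ ν))
  rw [← sq_eLpNorm_two]
  exact ENNReal.pow_ne_top hdiff.eLpNorm_ne_top

variable [BorelSpace E] {f : E → ℝ} {ℓ : ℝ≥0}

lemma sq_enorm_integral_sub_integral_le_of_mem_transportPlans {γ : Measure (E × E)}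
    (hγ : γ ∈ transportPlans μ ν) (hf : LipschitzWith ℓ f) (hfμ : Integrable f μ)
    (hfν : Integrable f ν) :
    ‖∫ x, f x ∂μ - ∫ x, f x ∂ν‖ₑ ^ 2 ≤ ℓ ^ 2 * ∫⁻ p, ‖p.1 - p.2‖ₑ ^ 2 ∂γ := by
  obtain ⟨rfl, rfl⟩ := hγ
  have : IsProbabilityMeasure γ := Measure.isProbabilityMeasure_of_map Prod.fst
  have hcont := hf.continuous
  have hfst : Integrable (fun p : E × E => f p.1) γ := hfμ.comp_measurable measurable_fst
  have hsnd : Integrable (fun p : E × E => f p.2) γ := hfν.comp_measurable measurable_snd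
  rw [integral_map (by fun_prop) hcont.aestronglyMeasurable,
    integral_map (by fun_prop) hcont.aestronglyMeasurable,
    ← integral_sub hfst hsnd]
  have hlip : eLpNorm (fun p : E × E => f p.1 - f p.2) 2 γ
      ≤ ℓ * eLpNorm (fun p : E × E => p.1 - p.2) 2 γ := by
    simpa only [ENNReal.smul_def, smul_eq_mul] using eLpNorm_le_nnreal_smul_eLpNorm_of_ae_le_mul
      (.of_forall fun p : E × E => hf.norm_sub_le p.1 p.2) 2
  calc ‖∫ p, f p.1 - f p.2 ∂γ‖ₑ ^ 2
      ≤ (ℓ * eLpNorm (fun p : E × E => p.1 - p.2) 2 γ) ^ 2 := by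
        gcongr
        exact (enorm_integral_le_eLpNorm_two (hfst.sub hsnd).1).trans hlip
    _ = ℓ ^ 2 * ∫⁻ p, ‖p.1 - p.2‖ₑ ^ 2 ∂γ := by
      rw [mul_pow, sq_eLpNorm_two]

theorem abs_integral_sub_integral_le_mul_W₂ [SecondCountableTopology E]
    [IsProbabilityMeasure ν] (hμ : MemLp (fun x => x) 2 μ) (hν : MemLp (fun x => x) 2 ν)
    (hf : LipschitzWith ℓ f) (hfμ : Integrable f μ) (hfν : Integrable f ν) :
    |∫ x, f x ∂μ - ∫ x, f x ∂ν| ≤ ℓ * W₂ μ ν := by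
  have hsq : ‖∫ x, f x ∂μ - ∫ x, f x ∂ν‖ₑ ^ 2 ≤ ℓ ^ 2 * wassersteinSq μ ν := by
    have : Nonempty (transportPlans μ ν) := ⟨_, prod_mem_transportPlans μ ν⟩
    rw [wassersteinSq, iInf_subtype', ENNReal.mul_iInf' (by simp) fun _ => this]
    exact le_iInf fun γ =>
      sq_enorm_integral_sub_integral_le_of_mem_transportPlans γ.2 hf hfμ hfν
  have hsq_real := ENNReal.toReal_mono
    (ENNReal.mul_ne_top (by simp) (wassersteinSq_ne_top hμ hν)) hsq
  simp only [ENNReal.toReal_pow, toReal_enorm, ENNReal.toReal_mul, ENNReal.coe_toReal,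
    Real.norm_eq_abs, sq_abs] at hsq_real
  refine abs_le_of_sq_le_sq ?_ (mul_nonneg ℓ.coe_nonneg (Real.sqrt_nonneg _))
  rwa [mul_pow, sq_W₂]

end Wasserstein

section Variance

variable {Ω E : Type*} [MeasurableSpace Ω] [NormedAddCommGroup E] {P : Measure Ω}

lemma vecVariance_comp_of_hasLaw [NormedSpace ℝ E] {Ω' : Type*} [MeasurableSpace Ω']
    {μ : Measure Ω'} {X : Ω → Ω'} (hX : HasLaw X μ P) {Y : Ω' → E}
    (hY : AEStronglyMeasurable Y μ) :
    vecVariance (fun ω => Y (X ω)) P = vecVariance Y μ := by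
  have hmean : ∫ ω, Y (X ω) ∂P = ∫ x, Y x ∂μ := hX.integral_comp hY
  rw [vecVariance, hmean]
  exact hX.lintegral_comp (f := fun x => ‖Y x - ∫ y, Y y ∂μ‖ₑ ^ 2)
    ((hY.sub aestronglyMeasurable_const).enorm.pow_const 2)

lemma vecVariance_eq_ofReal [NormedSpace ℝ E] [IsFiniteMeasure P] {Y : Ω → E}
    (hY : MemLp Y 2 P) :
    vecVariance Y P = ENNReal.ofReal (∫ ω, ‖Y ω - ∫ ω', Y ω' ∂P‖ ^ 2 ∂P) := by
  have hcentred : MemLp (fun ω => Y ω - ∫ ω', Y ω' ∂P) 2 P := hY.sub (memLp_const _)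
  rw [ofReal_integral_eq_lintegral_ofReal (hcentred.integrable_norm_pow two_ne_zero)
    (.of_forall fun ω => sq_nonneg _), vecVariance]
  simp only [ENNReal.ofReal_pow (norm_nonneg _), ofReal_norm]

variable [InnerProductSpace ℝ E] {Y D : Ω → E}

lemma integrable_inner_of_memLp_two (hY : MemLp Y 2 P) (hD : MemLp D 2 P) :
    Integrable (fun ω => inner ℝ (Y ω) (D ω)) P := by
  refine ((hY.integrable_norm_pow two_ne_zero).add
    (hD.integrable_norm_pow two_ne_zero)).mono' (hY.1.inner hD.1)
    (.of_forall fun ω => (norm_inner_le_norm _ _).trans ?_)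
  simp only [Pi.add_apply]
  nlinarith [two_mul_le_add_sq ‖Y ω‖ ‖D ω‖, norm_nonneg (Y ω), norm_nonneg (D ω)]

lemma integral_norm_sub_sq (hY : MemLp Y 2 P) (hD : MemLp D 2 P) :
    ∫ ω, ‖Y ω - D ω‖ ^ 2 ∂P
      = ∫ ω, ‖Y ω‖ ^ 2 ∂P - 2 * ∫ ω, inner ℝ (Y ω) (D ω) ∂P + ∫ ω, ‖D ω‖ ^ 2 ∂P := by
  have hYsq := hY.integrable_norm_pow two_ne_zero
  have hinner := (integrable_inner_of_memLp_two hY hD).const_mul 2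
  have hsub : Integrable (fun ω => ‖Y ω‖ ^ 2 - 2 * inner ℝ (Y ω) (D ω)) P := hYsq.sub hinner
  simp only [norm_sub_sq_real]
  rw [integral_add hsub (hD.integrable_norm_pow two_ne_zero),
    integral_sub hYsq hinner, integral_const_mul]

theorem vecVariance_sub_lt [CompleteSpace E] [IsFiniteMeasure P]
    (hY : MemLp Y 2 P) (hD : MemLp D 2 P) (hD_mean : ∫ ω, D ω ∂P = 0)
    (hlt : ∫ ω, ‖D ω‖ ^ 2 ∂P < 2 * ∫ ω, inner ℝ (Y ω) (D ω) ∂P) :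
    vecVariance (fun ω => Y ω - D ω) P < vecVariance Y P := by
  have hDi := hD.integrable one_le_two
  have hmean : ∫ ω, Y ω - D ω ∂P = ∫ ω, Y ω ∂P := by
    rw [integral_sub (hY.integrable one_le_two) hDi, hD_mean, sub_zero]
  set e := ∫ ω, Y ω ∂P with he
  have hcentred : MemLp (fun ω => Y ω - e) 2 P := hY.sub (memLp_const e)
  have hinner : ∫ ω, inner ℝ (Y ω - e) (D ω) ∂P = ∫ ω, inner ℝ (Y ω) (D ω) ∂P := by
    simp only [inner_sub_left]
    rw [integral_sub (integrable_inner_of_memLp_two hY hD) (hDi.const_inner e),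
      integral_inner hDi, hD_mean, inner_zero_right, sub_zero]
  have hsq := integral_norm_sub_sq hcentred hD
  simp only [sub_right_comm _ e, hinner] at hsq
  have hdiff : MemLp (fun ω => Y ω - D ω) 2 P := hY.sub hD
  rw [vecVariance_eq_ofReal hdiff, vecVariance_eq_ofReal hY,
    ENNReal.ofReal_lt_ofReal_iff_of_nonneg (integral_nonneg fun ω => sq_nonneg _)]
  simp only [hmean, ← he, hsq]
  linarith

end Variance

section ControlVariate

variable {d : ℕ} {V : EuclideanSpace ℝ (Fin d) → ℝ} {S : Matrix (Fin d) (Fin d) ℝ}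

lemma integral_fderiv_toEuclideanCLM_inv_sub_multivariateGaussian (hS : S.PosDef)
    (m : EuclideanSpace ℝ (Fin d)) (hV : ContDiff ℝ 2 V)
    (hgrowth' : HasPolynomialGrowth (fderiv ℝ V))
    (hΔ : Integrable (Δ V) (multivariateGaussian m S)) :
    ∫ x, fderiv ℝ V x (Matrix.toEuclideanCLM (𝕜 := ℝ) S⁻¹ (x - m)) ∂(multivariateGaussian m S)
      = ∫ x, Δ V x ∂(multivariateGaussian m S) := by
  have hV' := hV.continuous_fderiv two_ne_zero
  have hgrowth_inner : HasPolynomialGrowth fun x =>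
      fderiv ℝ V x (Matrix.toEuclideanCLM (𝕜 := ℝ) S⁻¹ (x - m)) := by fun_prop
  have stein := integral_inner_toEuclideanCLM_inv_sub_multivariateGaussian hS m
    (contDiff_gradient hV)
    (by
      simp only [inner_gradient_left]
      exact hgrowth_inner.integrable (Continuous.aestronglyMeasurable (by fun_prop)))
    (by rwa [divergence_gradient hV])
  simpa only [inner_gradient_left, divergence_gradient hV] using stein

lemma hasPolynomialGrowth_gradient (hgrowth' : HasPolynomialGrowth (fderiv ℝ V)) :
    HasPolynomialGrowth (∇ V) :=
  hgrowth'.mono fun _ => (LinearIsometryEquiv.norm_map _ _).le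

theorem vecVariance_cvEstimator_lt_vecVariance_mcEstimator (hV : ContDiff ℝ 2 V)
    (hgrowth' : HasPolynomialGrowth (fderiv ℝ V)) (hS : S.PosDef)
    {m : EuclideanSpace ℝ (Fin d)} (hΔ : Integrable (Δ V) (multivariateGaussian m S))
    {c : ℝ} (hc : 0 < c)
    (hlt : c * (S⁻¹).trace < 2 * ∫ x, Δ V x ∂(multivariateGaussian m S)) :
    vecVariance (cvEstimator V c m S) (multivariateGaussian m S)
      < vecVariance (mcEstimator V) (multivariateGaussian m S) := by
  have hgrad : MemLp (∇ V) 2 (multivariateGaussian m S) :=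
    (hasPolynomialGrowth_gradient hgrowth').memLp_two
      (contDiff_gradient hV).continuous.aestronglyMeasurable
  have hscore_growth : HasPolynomialGrowth fun x =>
      Matrix.toEuclideanCLM (𝕜 := ℝ) S⁻¹ (x - m) := by fun_prop
  have hscore : MemLp (fun x => Matrix.toEuclideanCLM (𝕜 := ℝ) S⁻¹ (x - m)) 2
      (multivariateGaussian m S) :=
    hscore_growth.memLp_two (Continuous.aestronglyMeasurable (by fun_prop))
  refine vecVariance_sub_lt hgrad (hscore.const_smul c) ?_ ?_
  · simp only [integral_smul, integral_toEuclideanCLM_inv_sub_multivariateGaussian, smul_zero]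
  · have hnorm_sq : ∫ x, ‖c • Matrix.toEuclideanCLM (𝕜 := ℝ) S⁻¹ (x - m)‖ ^ 2
        ∂(multivariateGaussian m S) = c * (c * (S⁻¹).trace) := by
      simp only [norm_smul, mul_pow, Real.norm_eq_abs, sq_abs, integral_const_mul,
        integral_norm_sq_toEuclideanCLM_inv_sub_multivariateGaussian hS]
      ring
    have hinner : ∫ x, inner ℝ (∇ V x) (c • Matrix.toEuclideanCLM (𝕜 := ℝ) S⁻¹ (x - m))
        ∂(multivariateGaussian m S) = c * ∫ x, Δ V x ∂(multivariateGaussian m S) := by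
      simp only [inner_smul_right, inner_gradient_left, integral_const_mul,
        integral_fderiv_toEuclideanCLM_inv_sub_multivariateGaussian hS m hV hgrowth' hΔ]
    rw [hnorm_sq, hinner]
    linarith [mul_lt_mul_of_pos_left hlt hc]

end ControlVariate

theorem mainTheorem1 (d : ℕ) (hd : 1 ≤ d)
    (V : EuclideanSpace ℝ (Fin d) → ℝ) (hV : ContDiff ℝ 2 V)
    (hint : Integrable (fun x => Real.exp (-V x)) volume)
    (ℓ : ℝ≥0) (hℓ : LipschitzWith ℓ (Δ V))
    (mhat : EuclideanSpace ℝ (Fin d)) (Shat : Matrix (Fin d) (Fin d) ℝ) (hShat : Shat.PosDef)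
    (hopt : IsOptimalGaussian V (multivariateGaussian mhat Shat))
    (c : ℝ) (hc : c ∈ Set.Ioo (0 : ℝ) 2) :
    0 < (2 - c) * (Shat⁻¹).trace ∧
    ∀ (m : EuclideanSpace ℝ (Fin d)) (S : Matrix (Fin d) (Fin d) ℝ), S.PosDef →
      2 * ℓ * W₂ (multivariateGaussian m S) (multivariateGaussian mhat Shat)
          + c * |(S⁻¹).trace - (Shat⁻¹).trace| < (2 - c) * (Shat⁻¹).trace →
      ∀ (Ω : Type*) [MeasurableSpace Ω] (P : Measure Ω) (X : Ω → EuclideanSpace ℝ (Fin d)),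
        HasLaw X (multivariateGaussian m S) P →
        vecVariance (fun ω => cvEstimator V c m S (X ω)) P
          < vecVariance (fun ω => mcEstimator V (X ω)) P := by
  have : Nonempty (Fin d) := ⟨⟨0, hd⟩⟩
  refine ⟨mul_pos (sub_pos.2 hc.2) hShat.inv.trace_pos, fun m S hS hclose Ω _ P X hX => ?_⟩
  have hΔ_growth := HasPolynomialGrowth.of_lipschitzWith hℓ
  have hgrowth := hasPolynomialGrowth_of_laplacian hV hΔ_growth hint
  have hgrowth' := hasPolynomialGrowth_fderiv_of_lipschitzWith_laplacian hV hℓ hgrowth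
  have hΔ (m S) : Integrable (Δ V) (multivariateGaussian m S) :=
    hΔ_growth.integrable hℓ.continuous.aestronglyMeasurable
  have hoptimal : ∫ x, Δ V x ∂(multivariateGaussian mhat Shat) = (Shat⁻¹).trace :=
    (integral_fderiv_toEuclideanCLM_inv_sub_multivariateGaussian hShat mhat hV hgrowth'
      (hΔ _ _)).symm.trans (hopt.integral_fderiv_toEuclideanCLM_sub_eq_trace hShat
        (hV.of_le one_le_two) hgrowth hgrowth' hint Shat⁻¹)
  have htransfer := abs_integral_sub_integral_le_mul_W₂ IsGaussian.memLp_two_id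
    IsGaussian.memLp_two_id hℓ (hΔ m S) (hΔ mhat Shat)
  have htrace := mul_le_mul_of_nonneg_left (le_abs_self ((S⁻¹).trace - (Shat⁻¹).trace)) hc.1.le
  have hlt : c * (S⁻¹).trace < 2 * ∫ x, Δ V x ∂(multivariateGaussian m S) := by
    linarith [(abs_le.1 htransfer).1]
  have hmc : Continuous (mcEstimator V) := (contDiff_gradient hV).continuous
  have hcv : Continuous (cvEstimator V c m S) := hmc.sub (by fun_prop)
  rw [vecVariance_comp_of_hasLaw hX hcv.aestronglyMeasurable,
    vecVariance_comp_of_hasLaw hX hmc.aestronglyMeasurable]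
  exact vecVariance_cvEstimator_lt_vecVariance_mcEstimator hV hgrowth' hS (hΔ m S) hc.1 hlt
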